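/- Let $\mathcal N_2$ be the germ of $F$-manifold $(\mathbb C^2,0)$ with coordinates $(t_1,t_2)$ and multiplication $\partial_1\circ\partial_1=\partial_1$, $\partial_1\circ\partial_2=\partial_2\circ\partial_1=\partial_2$, $\partial_2\circ\partial_2=0$ (unit field $e=\partial_1$). An Euler field on $\mathcal N_2$ is a germ at $0$ of a holomorphic vector field $E$ with $L_E(\circ)=\circ$. The group $\mathrm{Aut}(\mathcal N_2)$ of germs of biholomorphic maps $h:(\mathbb C^2,0)\to(\mathbb C^2,0)$ whose differential preserves $\circ$ acts on Euler fields by $E\mapsto h_*E$. A normal form of $E$ is an element of its orbit which belongs to the list $$(1)\ (t_1+c)\partial_1+\partial_2,\qquad (2)\ (t_1+c)\partial_1,\qquad (3)\ (t_1+c)\partial_1+c_0t_2\partial_2,\qquad (4)\ (t_1+c)\partial_1+t_2^{\,r}\bigl(1+c_1t_2^{\,r-1}\bigr)\partial_2,$$ with $c,c_1\in\mathbb C$, $c_0\in\mathbb C^*$, $r\in\mathbb Z_{\ge 2}$. Fix an open neighbourhood $\Delta$ of $0$ in $\mathbb C$ (for instance $\Delta=\mathbb C$, or a small disc). A $(TE)$-structure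 over an open neighbourhood $U$ of $0\in\mathbb C^2$ is a flat meromorphic connection on a trivial holomorphic vector bundle $H$ over $\Delta\times U$ with connection form $\Omega=\sum_{i}z^{-1}A_i(z,t)\,dt_i+z^{-2}B(z,t)\,dz$, where $A_i,B$ are holomorphic matrices on $\Delta\times U$. Put $C_X:=\sum_iX_iA_i(0,t)$ and $\mathcal U:=B(0,t)$. The structure induces the Euler field $E$ on $\mathcal N_2$ if the unfolding condition holds (locally on $U$ there is a holomorphic section $\zeta$ of $H|_{z=0}$ such that $X\mapsto C_X\zeta$ is an isomorphism $TU\to H|_{z=0}$) and, on $U$, $$C_{X\circ Y}=C_XC_Y,\qquad C_e=\mathrm{Id},\qquad C_E=-\,\mathcal U .$$ **Proposition.** An Euler field $E$ on $\mathcal N_2$ is induced by a $(TE)$-structure (over some neighbourhood $U$ of $0$) if and only if its normal form is of type (1), (2), (3), or of type (4) with $r=2$ and $c_1=0$. More precisely: $E$ is induced by a $(TE)$-structure if and only if $E$ has a normal form of one of these types; and, whenever $N$ is a normal form of $E$, $E$ is induced by a $(TE)$-structure if and only if $N$ is of one of these types. -/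

import Mathlib

open scoped Topology

noncomputable section

/-! ### The `F`-manifold germ `𝓝₂`: the germ `(ℂ², 0)` with coordinates `(t₁, t₂)`
(Lean indices `0` and `1`).  Vector fields are functions `ℂ² → ℂ²`, `X = X₀ ∂₁ + X₁ ∂₂`,
considered near the origin. -/

namespace N2

/-- The multiplication on tangent vectors of `𝓝₂`:
`∂₁ ∘ ∂₁ = ∂₁`, `∂₁ ∘ ∂₂ = ∂₂ ∘ ∂₁ = ∂₂`, `∂₂ ∘ ∂₂ = 0`. -/
def mul (X Y : Fin 2 → ℂ) : Fin 2 → ℂ :=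
  ![X 0 * Y 0, X 0 * Y 1 + X 1 * Y 0]

/-- The unit field `∂₁`. -/
def unit : Fin 2 → ℂ := ![1, 0]

/-- `E` is a germ at `0` of an Euler field: it is holomorphic and `L_E(∘) = ∘`, that is
`[E, X ∘ Y] - [E, X] ∘ Y - X ∘ [E, Y] = X ∘ Y` for all germs of holomorphic vector fields. -/
def IsEulerField (E : (Fin 2 → ℂ) → (Fin 2 → ℂ)) : Prop :=
  AnalyticAt ℂ E 0 ∧
    ∀ X Y : (Fin 2 → ℂ) → (Fin 2 → ℂ), AnalyticAt ℂ X 0 → AnalyticAt ℂ Y 0 →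
      ∀ᶠ t in 𝓝 (0 : Fin 2 → ℂ),
        VectorField.lieBracket ℂ E (fun s => mul (X s) (Y s)) t
          - mul (VectorField.lieBracket ℂ E X t) (Y t)
          - mul (X t) (VectorField.lieBracket ℂ E Y t)
        = mul (X t) (Y t)

/-- `h` is (a representative of) an automorphism of the `F`-manifold germ `𝓝₂`: a germ of a
biholomorphic map `(ℂ², 0) → (ℂ², 0)` whose differential preserves the multiplication. -/
def IsAutomorphism (h : (Fin 2 → ℂ) → (Fin 2 → ℂ)) : Prop :=
  AnalyticAt ℂ h 0 ∧ h 0 = 0 ∧ Function.Bijective (fderiv ℂ h 0) ∧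
    ∀ᶠ t in 𝓝 (0 : Fin 2 → ℂ), ∀ u v : Fin 2 → ℂ,
      fderiv ℂ h t (mul u v) = mul (fderiv ℂ h t u) (fderiv ℂ h t v)

/-- `E` and `F` are in the same orbit of the automorphism group of `𝓝₂`: `h_* E = F` as germs
for some automorphism `h`. -/
def SameOrbit (E F : (Fin 2 → ℂ) → (Fin 2 → ℂ)) : Prop :=
  ∃ h : (Fin 2 → ℂ) → (Fin 2 → ℂ), IsAutomorphism h ∧
    ∀ᶠ t in 𝓝 (0 : Fin 2 → ℂ), fderiv ℂ h t (E t) = F (h t)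

/-- The list of normal forms of Euler fields on `𝓝₂`. -/
inductive EulerNormalForm : Type where
  /-- `(t₁ + c) ∂₁ + ∂₂` -/
  | translation (c : ℂ)
  /-- `(t₁ + c) ∂₁` -/
  | trivial (c : ℂ)
  /-- `(t₁ + c) ∂₁ + c₀ t₂ ∂₂` with `c₀ ≠ 0` -/
  | linear (c c₀ : ℂ) (hc₀ : c₀ ≠ 0)
  /-- `(t₁ + c) ∂₁ + t₂ ^ r (1 + c₁ t₂ ^ (r - 1)) ∂₂` with `r ≥ 2` -/
  | higher (c c₁ : ℂ) (r : ℕ) (hr : 2 ≤ r)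

namespace EulerNormalForm

/-- The vector field given by a normal form. -/
def field : EulerNormalForm → (Fin 2 → ℂ) → (Fin 2 → ℂ)
  | translation c => fun t => ![t 0 + c, 1]
  | trivial c => fun t => ![t 0 + c, 0]
  | linear c c₀ _ => fun t => ![t 0 + c, c₀ * t 1]
  | higher c c₁ r _ => fun t => ![t 0 + c, t 1 ^ r * (1 + c₁ * t 1 ^ (r - 1))]

/-- The normal form is of one of the first three types, or of the last type with
`r = 2` and `c₁ = 0`. -/
def IsListed : EulerNormalForm → Prop
  | translation _ => True
  | trivial _ => True
  | linear _ _ _ => True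
  | higher _ c₁ r _ => r = 2 ∧ c₁ = 0

end EulerNormalForm

/-- `N` is a normal form of the Euler field `E`. -/
def HasNormalForm (E : (Fin 2 → ℂ) → (Fin 2 → ℂ)) (N : EulerNormalForm) : Prop :=
  SameOrbit E N.field

end N2

/-! ### `(TE)`-structures -/

/-- Entrywise partial derivative with respect to `z` of a matrix valued function of `(z, t)`. -/
def matrixDz {m r : ℕ} (F : ℂ × (Fin m → ℂ) → Matrix (Fin r) (Fin r) ℂ)
    (p : ℂ × (Fin m → ℂ)) : Matrix (Fin r) (Fin r) ℂ :=
  Matrix.of fun a b => fderiv ℂ (fun q => F q a b) p (1, 0)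

/-- Entrywise partial derivative with respect to `tᵢ` of a matrix valued function of `(z, t)`. -/
def matrixDt {m r : ℕ} (i : Fin m) (F : ℂ × (Fin m → ℂ) → Matrix (Fin r) (Fin r) ℂ)
    (p : ℂ × (Fin m → ℂ)) : Matrix (Fin r) (Fin r) ℂ :=
  Matrix.of fun a b => fderiv ℂ (fun q => F q a b) p (0, Pi.single i 1)

/-- A (holomorphic) `(TE)`-structure over `U ⊆ ℂᵐ` on the trivial bundle of rank `r` over `Δ × U`:
a meromorphic connection with connection form `Ω = ∑ᵢ z⁻¹ Aᵢ(z,t) dtᵢ + z⁻² B(z,t) dz`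
with `Aᵢ` and `B` holomorphic, which is flat, `dΩ + Ω ∧ Ω = 0`.  The two fields `flat_tt` and
`flat_zt` are the components of this equation, multiplied by `z²` and `z³`. -/
structure TEStructure (m r : ℕ) (Δ : Set ℂ) (U : Set (Fin m → ℂ)) where
  A : Fin m → ℂ × (Fin m → ℂ) → Matrix (Fin r) (Fin r) ℂ
  B : ℂ × (Fin m → ℂ) → Matrix (Fin r) (Fin r) ℂ
  holo_A : ∀ i a b, AnalyticOnNhd ℂ (fun p => A i p a b) (Δ ×ˢ U)
  holo_B : ∀ a b, AnalyticOnNhd ℂ (fun p => B p a b) (Δ ×ˢ U)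
  flat_tt : ∀ i j, ∀ p ∈ Δ ×ˢ U,
    p.1 • matrixDt i (A j) p - p.1 • matrixDt j (A i) p
      + (A i p * A j p - A j p * A i p) = 0
  flat_zt : ∀ i, ∀ p ∈ Δ ×ˢ U,
    p.1 • matrixDt i B p - p.1 ^ 2 • matrixDz (A i) p + p.1 • A i p
      + (A i p * B p - B p * A i p) = 0

namespace TEStructure

variable {m r : ℕ} {Δ : Set ℂ} {U : Set (Fin m → ℂ)}

/-- The Higgs field: `C_X = [z ∇_X]` on the restriction of the bundle to `z = 0`. -/
def higgs (S : TEStructure m r Δ U) (t X : Fin m → ℂ) : Matrix (Fin r) (Fin r) ℂ :=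
  ∑ i, X i • S.A i (0, t)

/-- The endomorphism `𝓤 = [z ∇_{z ∂_z}]` of the restriction of the bundle to `z = 0`. -/
def poleEnd (S : TEStructure m r Δ U) (t : Fin m → ℂ) : Matrix (Fin r) (Fin r) ℂ :=
  S.B (0, t)

/-- The unfolding condition: locally on `U` there is a primitive section, i.e. a holomorphic
section `ζ` of the restriction of the bundle to `z = 0` such that `X ↦ C_X ζ` is an isomorphism
from the tangent bundle onto this restriction. -/
def Unfolding (S : TEStructure m r Δ U) : Prop :=
  ∀ p ∈ U, ∃ V : Set (Fin m → ℂ), IsOpen V ∧ p ∈ V ∧ V ⊆ U ∧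
    ∃ ζ : (Fin m → ℂ) → (Fin r → ℂ), AnalyticOnNhd ℂ ζ V ∧
      ∀ t ∈ V, Function.Bijective fun X : Fin m → ℂ => (S.higgs t X).mulVec (ζ t)

/-- The `(TE)`-structure satisfies the unfolding condition and the `F`-manifold structure which
it induces, through `C_{X ∘ Y} = C_X C_Y` and `C_e = Id`, is that of `𝓝₂`. -/
def LiesOverN2 {U : Set (Fin 2 → ℂ)} (S : TEStructure 2 r Δ U) : Prop :=
  S.Unfolding ∧
    (∀ t ∈ U, ∀ X Y : Fin 2 → ℂ, S.higgs t (N2.mul X Y) = S.higgs t X * S.higgs t Y) ∧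
    ∀ t ∈ U, S.higgs t N2.unit = 1

end TEStructure

/-- The germ at `0` of the vector field `E` is induced by a `(TE)`-structure over the germ `𝓝₂`,
i.e. by a `(TE)`-structure over some open neighbourhood `U` of `0` which lies over `𝓝₂`,
with `C_E = -𝓤`.  The variable `z` of the structure ranges over `Δ`. -/
def N2.IsInducedByTE (Δ : Set ℂ) (E : (Fin 2 → ℂ) → (Fin 2 → ℂ)) : Prop :=
  ∃ U : Set (Fin 2 → ℂ), IsOpen U ∧ 0 ∈ U ∧ ∃ (r : ℕ) (S : TEStructure 2 r Δ U),
    S.LiesOverN2 ∧ ∀ t ∈ U, S.higgs t (E t) = - S.poleEnd t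

end

/-! In coordinates an Euler field is `(t₁ + c) ∂₁ + g(t₂) ∂₂` and an automorphism is `(t₁, t₂) ↦
(t₁, φ(t₂))`. So everything depends on the germ `g(x) d/dx` up to changes of the coordinate `x`. A
listed normal form exists exactly when `N2.HasListedJet g` holds: `g` is zero, or vanishes to order
at most one, or vanishes to order two with `g'''(0) = 0`. In the last case the jet condition says
that `dx/g` has no residue, which is the obstruction to transforming `g` into `x²`.

Necessity. The unfolding condition forces rank two. Along `t₁ = 0` write `A₂ = N + zP + z²Q + …` and
`B = -(c + gN) + zB₁ + z²B₂ + …`; here `N ≠ 0` and `N² = 0`. Suppose `g(0) = g'(0) = 0` and `g` is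
not identically zero. The `z` and `z²` coefficients of flatness give `g b' = (1 - g') b` for `b =
tr(N B₁)`, and comparing orders at `0` gives `b = 0`. Hence `[N, B₁] = -h N` for a function `h`. Put
`κ = tr(N Q)` and `β = tr(N B₂)`. Dividing by `g` away from `0` gives `N' + [P, N] = d N` with `d`
holomorphic at `0`, and then `h = 1 - g' - g d`, `h' = -2(β + gκ)`, `β' = dβ + (1 - h)κ`, the last
one from the `z³` coefficient. Eliminating `h` and `β` leaves `g''' = u g' + v g` with `u`, `v`
holomorphic (`exists_third_order_of_flat`). There is no `g''` term, so `g'''(0) = 0`; and if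
`g''(0)` vanished as well, `g` would be identically zero.

Sufficiency. The simplest solutions of this equation, `g''' = 0`, are the quadratic polynomials. For
them there is an explicit connection polynomial in `z` (`quadraticB`), and pulling it back by `φ`
realizes every Euler field with a listed normal form. -/

noncomputable section

/-! ### Holomorphic functions near the origin -/

/-- A function of several variables whose partial derivative in one direction vanishes does not
depend on that coordinate. -/
theorem eventually_eq_update_of_fderiv_single {f : (Fin 2 → ℂ) → ℂ} (hf : AnalyticAt ℂ f 0)
    (i : Fin 2) (h : ∀ᶠ t in 𝓝 (0 : Fin 2 → ℂ), fderiv ℂ f t (Pi.single i 1) = 0) :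
    ∀ᶠ t in 𝓝 (0 : Fin 2 → ℂ), f t = f (Function.update t i 0) := by
  obtain ⟨ε, hε, hball⟩ := Metric.eventually_nhds_iff_ball.1 (hf.eventually_analyticAt.and h)
  filter_upwards [Metric.ball_mem_nhds _ hε] with t ht
  have hmem : ∀ s ∈ Metric.ball (0 : ℂ) ε, Function.update t i s ∈ Metric.ball (0 : Fin 2 → ℂ) ε := by
    intro s hs
    rw [mem_ball_zero_iff] at hs ht ⊢
    rw [pi_norm_lt_iff hε] at ht ⊢
    intro j
    by_cases hj : j = i
    · subst hj; simpa using hs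
    · simpa [Function.update_of_ne hj] using ht j
  have hder : ∀ s ∈ Metric.ball (0 : ℂ) ε,
      HasDerivAt (fun s => f (Function.update t i s)) 0 s := by
    intro s hs
    have h1 := hball _ (hmem s hs)
    have h2 := h1.1.differentiableAt.hasFDerivAt.comp_hasDerivAt s (hasDerivAt_update t i s)
    rwa [h1.2] at h2
  have key := Metric.isOpen_ball.is_const_of_deriv_eq_zero (𝕜 := ℂ)
    (convex_ball (0 : ℂ) ε).isPreconnected
    (fun s hs => (hder s hs).differentiableAt.differentiableWithinAt)
    (fun s hs => (hder s hs).deriv)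
    (x := t i) (y := 0)
    (by
      rw [mem_ball_zero_iff] at ht ⊢
      exact (norm_le_pi_norm t i).trans_lt ht)
    (Metric.mem_ball_self hε)
  simpa using key

/-- A holomorphic function has a holomorphic primitive near the origin. -/
theorem AnalyticAt.exists_primitive {f : ℂ → ℂ} (hf : AnalyticAt ℂ f 0) (y : ℂ) :
    ∃ F : ℂ → ℂ, AnalyticAt ℂ F 0 ∧ F 0 = y ∧ ∀ᶠ x in 𝓝 0, HasDerivAt F (f x) x := by
  obtain ⟨ε, hε, hball⟩ := Metric.eventually_nhds_iff_ball.1 hf.eventually_analyticAt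
  have hd : DifferentiableOn ℂ f (Metric.ball 0 ε) := fun x hx =>
    (hball x hx).differentiableAt.differentiableWithinAt
  obtain ⟨G, hG⟩ := hd.isExactOn_ball
  have hG' : ∀ x ∈ Metric.ball (0 : ℂ) ε, HasDerivAt (fun x => G x - G 0 + y) (f x) x :=
    fun x hx => ((hG x hx).sub_const _).add_const _
  refine ⟨fun x => G x - G 0 + y, ?_, by simp, ?_⟩
  · exact DifferentiableOn.analyticAt
      (fun x hx => (hG' x hx).differentiableAt.differentiableWithinAt)
      (Metric.ball_mem_nhds _ hε)
  · filter_upwards [Metric.ball_mem_nhds _ hε] with x hx using hG' x hx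

/-- Division by the coordinate. -/
theorem AnalyticAt.exists_eq_mul_of_zero {f : ℂ → ℂ} (hf : AnalyticAt ℂ f 0) (h0 : f 0 = 0) :
    ∃ u : ℂ → ℂ, AnalyticAt ℂ u 0 ∧ u 0 = deriv f 0 ∧ ∀ᶠ x in 𝓝 0, f x = x * u x := by
  have h1 : ((1 : ℕ) : ℕ∞) ≤ analyticOrderAt f 0 := by
    rw [Nat.cast_one, Order.one_le_iff_ne_zero]
    exact hf.analyticOrderAt_ne_zero.2 h0
  obtain ⟨u, hu, hfu⟩ := (natCast_le_analyticOrderAt hf).1 h1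
  have hfu' : f =ᶠ[𝓝 0] fun x => x * u x := by
    filter_upwards [hfu] with x hx
    simpa using hx
  refine ⟨u, hu, ?_, hfu'⟩
  rw [hfu'.deriv_eq]
  symm
  refine HasDerivAt.deriv
    (((hasDerivAt_id (0 : ℂ)).mul hu.differentiableAt.hasDerivAt).congr_deriv ?_)
  simp

/-- The `3`-jet of a function of the form `x² u`. -/
theorem derivs_of_eq_sq_mul {f u : ℂ → ℂ} (hu : AnalyticAt ℂ u 0)
    (hfu : ∀ᶠ x in 𝓝 0, f x = x ^ 2 * u x) :
    f 0 = 0 ∧ deriv f 0 = 0 ∧ deriv (deriv f) 0 = 2 * u 0 ∧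
      deriv (deriv (deriv f)) 0 = 6 * deriv u 0 := by
  have hd1 : deriv f =ᶠ[𝓝 0] fun x => 2 * x * u x + x ^ 2 * deriv u x := by
    refine (Filter.EventuallyEq.deriv hfu).trans ?_
    filter_upwards [hu.eventually_analyticAt] with x hx
    refine HasDerivAt.deriv
      (((hasDerivAt_pow 2 x).mul hx.differentiableAt.hasDerivAt).congr_deriv ?_)
    simp
  have hd2 : deriv (deriv f) =ᶠ[𝓝 0]
      fun x => 2 * u x + 4 * x * deriv u x + x ^ 2 * deriv (deriv u) x := by
    refine hd1.deriv.trans ?_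
    filter_upwards [hu.eventually_analyticAt] with x hx
    have h1 := (((hasDerivAt_id x).const_mul 2).mul hx.differentiableAt.hasDerivAt).add
      ((hasDerivAt_pow 2 x).mul hx.deriv.differentiableAt.hasDerivAt)
    refine HasDerivAt.deriv (h1.congr_deriv ?_)
    simp; ring
  refine ⟨by simpa using hfu.self_of_nhds, by simpa using hd1.eq_of_nhds,
    by simpa using hd2.eq_of_nhds, ?_⟩
  have h1 := ((hu.differentiableAt.hasDerivAt.const_mul 2).add
    (((hasDerivAt_id (0 : ℂ)).const_mul 4).mul hu.deriv.differentiableAt.hasDerivAt)).add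
    ((hasDerivAt_pow 2 (0 : ℂ)).mul hu.deriv.deriv.differentiableAt.hasDerivAt)
  rw [hd2.deriv_eq]
  refine HasDerivAt.deriv (h1.congr_deriv ?_)
  simp; ring

/-- Division by the square of the coordinate. -/
theorem AnalyticAt.exists_eq_sq_mul {f : ℂ → ℂ} (hf : AnalyticAt ℂ f 0) (h0 : f 0 = 0)
    (h1 : deriv f 0 = 0) :
    ∃ u : ℂ → ℂ, AnalyticAt ℂ u 0 ∧ ∀ᶠ x in 𝓝 0, f x = x ^ 2 * u x := by
  obtain ⟨v, hv, hv0, hfv⟩ := hf.exists_eq_mul_of_zero h0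
  obtain ⟨u, hu, -, hvu⟩ := hv.exists_eq_mul_of_zero (hv0.trans h1)
  refine ⟨u, hu, ?_⟩
  filter_upwards [hfv, hvu] with x hx hx'
  rw [hx, hx']; ring

theorem analyticOrderAt_le_mul_left {f u : ℂ → ℂ} (hf : AnalyticAt ℂ f 0)
    (hu : AnalyticAt ℂ u 0) : analyticOrderAt f 0 ≤ analyticOrderAt (f * u) 0 := by
  rw [analyticOrderAt_mul hf hu]
  exact le_self_add

/-- A solution of `g b' = (1 - g') b` vanishes if `g` vanishes to second order. -/
theorem eventually_zero_of_mul_deriv_eq {g b : ℂ → ℂ} (hg : AnalyticAt ℂ g 0)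
    (hb : AnalyticAt ℂ b 0) (h0 : g 0 = 0) (h1 : deriv g 0 = 0)
    (h : ∀ᶠ x in 𝓝 0, g x * deriv b x = (1 - deriv g x) * b x) : ∀ᶠ x in 𝓝 0, b x = 0 := by
  by_contra hne
  have htop : analyticOrderAt b 0 ≠ ⊤ := fun h => hne (analyticOrderAt_eq_top.1 h)
  obtain ⟨u, hu, hu0, hbu⟩ := hb.analyticOrderAt_ne_top.1 htop
  obtain ⟨γ, hγ, hgγ⟩ := hg.exists_eq_sq_mul h0 h1
  set m := analyticOrderNatAt b 0
  have hbu' : b =ᶠ[𝓝 0] fun x => x ^ m * u x := by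
    filter_upwards [hbu] with x hx; simpa using hx
  -- With `b = x^m u` and `g = x² γ`, both sides are divisible by `x^m`. What is left of `g b'`
  -- still has a factor `x`, whereas `(1 - g') u` has the value `u 0 ≠ 0` at the origin.
  have key : ∀ᶠ x in 𝓝[≠] (0 : ℂ),
      x * γ x * (m * u x + x * deriv u x) - (1 - deriv g x) * u x = 0 := by
    filter_upwards [h.filter_mono nhdsWithin_le_nhds, hbu'.filter_mono nhdsWithin_le_nhds,
      hbu'.deriv.filter_mono nhdsWithin_le_nhds, hgγ.filter_mono nhdsWithin_le_nhds,
      hu.eventually_analyticAt.filter_mono nhdsWithin_le_nhds, self_mem_nhdsWithin]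
      with x hx hbx hdb hgx hux hx0
    have hx0 : x ≠ 0 := hx0
    have hd' : deriv b x = m * x ^ (m - 1) * u x + x ^ m * deriv u x := by
      rw [hdb]
      exact ((hasDerivAt_pow m x).mul hux.differentiableAt.hasDerivAt).deriv
    have hpow : (m : ℂ) * x ^ (m - 1) * x = m * x ^ m := by
      rcases Nat.eq_zero_or_pos m with hm | hm
      · simp [hm]
      · rw [mul_assoc, ← pow_succ, Nat.sub_add_cancel hm]
    rw [hd', hbx, hgx] at hx
    have : x ^ m * (x * γ x * (m * u x + x * deriv u x) - (1 - deriv g x) * u x) = 0 := by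
      linear_combination hx - x * γ x * u x * hpow
    exact (mul_eq_zero.1 this).resolve_left (pow_ne_zero _ hx0)
  have hcont : ContinuousAt (fun x : ℂ =>
      x * γ x * (m * u x + x * deriv u x) - (1 - deriv g x) * u x) 0 := by
    have := hu.continuousAt
    have := hu.deriv.continuousAt
    have := hγ.continuousAt
    have := hg.deriv.continuousAt
    fun_prop
  have hlim := tendsto_nhds_unique (hcont.tendsto.mono_left nhdsWithin_le_nhds)
    (tendsto_const_nhds.congr' (key.mono fun x hx => hx.symm))
  simp [h1, hu0] at hlim

/-- A solution of `g''' = g' u + g v` with `g(0) = g'(0) = g''(0) = 0` vanishes. -/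
theorem eventually_zero_of_third_order {g u v : ℂ → ℂ} (hg : AnalyticAt ℂ g 0)
    (hu : AnalyticAt ℂ u 0) (hv : AnalyticAt ℂ v 0) (h0 : g 0 = 0) (h1 : deriv g 0 = 0)
    (h2 : deriv (deriv g) 0 = 0)
    (h : ∀ᶠ x in 𝓝 0, deriv (deriv (deriv g)) x = deriv g x * u x + g x * v x) :
    ∀ᶠ x in 𝓝 0, g x = 0 := by
  by_contra hne
  -- Each differentiation lowers the order by exactly one because the value differentiated is zero
  -- at `0`. Thus `g'` has order two more than `g'''`, while the equation bounds the order of `g'`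
  -- by that of `g'''`; only infinite order is possible.
  have e1 := hg.analyticOrderAt_deriv_add_one
  have e2 := hg.deriv.analyticOrderAt_deriv_add_one
  have e3 := hg.deriv.deriv.analyticOrderAt_deriv_add_one
  simp only [h0, h1, h2, sub_zero] at e1 e2 e3
  have h' : deriv (deriv (deriv g)) =ᶠ[𝓝 0] deriv g * u + g * v := h
  have hle : analyticOrderAt (deriv g) 0 ≤ analyticOrderAt (deriv (deriv (deriv g))) 0 := by
    rw [analyticOrderAt_congr h']
    refine le_trans (le_min ?_ ?_) le_analyticOrderAt_add
    · exact analyticOrderAt_le_mul_left hg.deriv hu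
    · refine le_trans ?_ (analyticOrderAt_le_mul_left hg hv)
      change _ ≤ analyticOrderAt (fun x => g x) 0
      rw [← e1]; exact le_self_add
  have htop : analyticOrderAt g 0 ≠ ⊤ := fun h => hne (analyticOrderAt_eq_top.1 h)
  change _ = analyticOrderAt g 0 at e1
  change _ = analyticOrderAt (deriv g) 0 at e2
  change _ = analyticOrderAt (deriv (deriv g)) 0 at e3
  rw [← e1, ← e2, ← e3] at htop
  rw [← e2, ← e3] at hle
  generalize analyticOrderAt (deriv (deriv (deriv g))) 0 = k at hle htop
  cases k with
  | top => simp at htop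
  | coe k => norm_cast at hle; omega

/-! ### Partial derivatives of functions of two variables -/

/-- The directional derivative. -/
def dirDeriv (v : ℂ × ℂ) (F : ℂ × ℂ → ℂ) (p : ℂ × ℂ) : ℂ := fderiv ℂ F p v

theorem AnalyticAt.dirDeriv {F : ℂ × ℂ → ℂ} {p : ℂ × ℂ} (hF : AnalyticAt ℂ F p) (v : ℂ × ℂ) :
    AnalyticAt ℂ (dirDeriv v F) p :=
  (ContinuousLinearMap.apply ℂ ℂ v).analyticAt _ |>.comp hF.fderiv

theorem dirDeriv_congr {F G : ℂ × ℂ → ℂ} {p : ℂ × ℂ} (h : F =ᶠ[𝓝 p] G) (v : ℂ × ℂ) :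
    dirDeriv v F =ᶠ[𝓝 p] dirDeriv v G := by
  filter_upwards [h.fderiv (𝕜 := ℂ)] with q hq
  simp only [dirDeriv, hq]

theorem dirDeriv_mul {F G : ℂ × ℂ → ℂ} {p : ℂ × ℂ} (hF : AnalyticAt ℂ F p)
    (hG : AnalyticAt ℂ G p) (v : ℂ × ℂ) :
    dirDeriv v (F * G) =ᶠ[𝓝 p] dirDeriv v F * G + F * dirDeriv v G := by
  filter_upwards [hF.eventually_analyticAt, hG.eventually_analyticAt] with q hq hq'
  simp only [dirDeriv, fderiv_mul hq.differentiableAt hq'.differentiableAt, Pi.add_apply,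
    Pi.mul_apply, add_apply, smul_apply, smul_eq_mul]
  ring

theorem dirDeriv_add {F G : ℂ × ℂ → ℂ} {p : ℂ × ℂ} (hF : AnalyticAt ℂ F p)
    (hG : AnalyticAt ℂ G p) (v : ℂ × ℂ) :
    dirDeriv v (F + G) =ᶠ[𝓝 p] dirDeriv v F + dirDeriv v G := by
  filter_upwards [hF.eventually_analyticAt, hG.eventually_analyticAt] with q hq hq'
  simp only [dirDeriv, fderiv_add hq.differentiableAt hq'.differentiableAt, Pi.add_apply,
    add_apply]

theorem dirDeriv_sub {F G : ℂ × ℂ → ℂ} {p : ℂ × ℂ} (hF : AnalyticAt ℂ F p)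
    (hG : AnalyticAt ℂ G p) (v : ℂ × ℂ) :
    dirDeriv v (F - G) =ᶠ[𝓝 p] dirDeriv v F - dirDeriv v G := by
  filter_upwards [hF.eventually_analyticAt, hG.eventually_analyticAt] with q hq hq'
  simp only [dirDeriv, fderiv_sub hq.differentiableAt hq'.differentiableAt, Pi.sub_apply,
    sub_apply]

theorem dirDeriv_comm {F : ℂ × ℂ → ℂ} {p : ℂ × ℂ} (hF : AnalyticAt ℂ F p) (v w : ℂ × ℂ) :
    dirDeriv v (dirDeriv w F) =ᶠ[𝓝 p] dirDeriv w (dirDeriv v F) := by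
  filter_upwards [hF.eventually_analyticAt] with q hq
  have hsymm : IsSymmSndFDerivAt ℂ F q :=
    (hq.contDiffAt (n := 2)).isSymmSndFDerivAt (by simp)
  have key : ∀ a b : ℂ × ℂ, dirDeriv a (dirDeriv b F) q = fderiv ℂ (fderiv ℂ F) q a b := by
    intro a b
    have h1 : HasFDerivAt (dirDeriv b F)
        ((ContinuousLinearMap.apply ℂ ℂ b).comp (fderiv ℂ (fderiv ℂ F) q)) q :=
      (ContinuousLinearMap.apply ℂ ℂ b).hasFDerivAt.comp q
        hq.fderiv.differentiableAt.hasFDerivAt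
    rw [dirDeriv, h1.fderiv]
    simp
  rw [key, key]
  exact hsymm v w

/-- The restriction to `z = 0` of the partial derivative in `x`. -/
theorem hasDerivAt_slice {F : ℂ × ℂ → ℂ} {x : ℂ} (hF : AnalyticAt ℂ F (0, x)) :
    HasDerivAt (fun x => F (0, x)) (dirDeriv (0, 1) F (0, x)) x := by
  have h1 : HasDerivAt (fun x : ℂ => ((0 : ℂ), x)) ((0 : ℂ), (1 : ℂ)) x :=
    (hasDerivAt_const x (0 : ℂ)).prodMk (hasDerivAt_id x)
  exact hF.differentiableAt.hasFDerivAt.comp_hasDerivAt x h1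

theorem continuous_slice : Continuous (fun x : ℂ => ((0 : ℂ), x)) := by fun_prop

theorem AnalyticAt.slice {F : ℂ × ℂ → ℂ} {x : ℂ} (hF : AnalyticAt ℂ F (0, x)) :
    AnalyticAt ℂ (fun x => F (0, x)) x :=
  AnalyticAt.comp (g := F) (f := fun x : ℂ => ((0 : ℂ), x)) hF
    (analyticAt_const.prod analyticAt_id)

theorem eventually_slice {P : ℂ × ℂ → Prop} (h : ∀ᶠ p in 𝓝 (0 : ℂ × ℂ), P p) :
    ∀ᶠ x in 𝓝 (0 : ℂ), P (0, x) :=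
  (continuous_slice.tendsto' 0 0 rfl).eventually h

/-- The entries of the commutator of two matrices of functions. -/
def commEntry (a b : Fin 2 → Fin 2 → ℂ × ℂ → ℂ) (i j : Fin 2) : ℂ × ℂ → ℂ :=
  (a i 0 * b 0 j + a i 1 * b 1 j) - (b i 0 * a 0 j + b i 1 * a 1 j)

theorem AnalyticAt.commEntry {a b : Fin 2 → Fin 2 → ℂ × ℂ → ℂ} {p : ℂ × ℂ}
    (ha : ∀ i j, AnalyticAt ℂ (a i j) p) (hb : ∀ i j, AnalyticAt ℂ (b i j) p) (i j : Fin 2) :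
    AnalyticAt ℂ (commEntry a b i j) p :=
  (((ha i 0).mul (hb 0 j)).add ((ha i 1).mul (hb 1 j))).sub
    (((hb i 0).mul (ha 0 j)).add ((hb i 1).mul (ha 1 j)))

/-- The entrywise directional derivative. -/
def entryDeriv (v : ℂ × ℂ) (a : Fin 2 → Fin 2 → ℂ × ℂ → ℂ) : Fin 2 → Fin 2 → ℂ × ℂ → ℂ :=
  fun i j => dirDeriv v (a i j)

theorem dirDeriv_commEntry {a b : Fin 2 → Fin 2 → ℂ × ℂ → ℂ} {p : ℂ × ℂ}
    (ha : ∀ i j, AnalyticAt ℂ (a i j) p) (hb : ∀ i j, AnalyticAt ℂ (b i j) p)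
    (v : ℂ × ℂ) (i j : Fin 2) :
    dirDeriv v (commEntry a b i j) =ᶠ[𝓝 p]
      commEntry (entryDeriv v a) b i j + commEntry a (entryDeriv v b) i j := by
  refine (dirDeriv_sub (((ha i 0).mul (hb 0 j)).add ((ha i 1).mul (hb 1 j)))
    (((hb i 0).mul (ha 0 j)).add ((hb i 1).mul (ha 1 j))) v).trans ?_
  filter_upwards [dirDeriv_add ((ha i 0).mul (hb 0 j)) ((ha i 1).mul (hb 1 j)) v,
    dirDeriv_add ((hb i 0).mul (ha 0 j)) ((hb i 1).mul (ha 1 j)) v,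
    dirDeriv_mul (ha i 0) (hb 0 j) v, dirDeriv_mul (ha i 1) (hb 1 j) v,
    dirDeriv_mul (hb i 0) (ha 0 j) v, dirDeriv_mul (hb i 1) (ha 1 j) v]
    with q h1 h2 h3 h4 h5 h6
  simp only [Pi.sub_apply, h1, h2, Pi.add_apply, h3, h4, h5, h6, Pi.mul_apply, commEntry,
    entryDeriv]
  ring

/-- The Taylor coefficients of a relation `z Y + C = 0` along `z = 0`. -/
theorem taylor_of_fst_mul_add {Y C : ℂ × ℂ → ℂ} (hY : AnalyticAt ℂ Y 0) (hC : AnalyticAt ℂ C 0)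
    (h : ∀ᶠ p in 𝓝 (0 : ℂ × ℂ), p.1 * Y p + C p = 0) :
    ∀ᶠ x in 𝓝 (0 : ℂ), Y (0, x) + dirDeriv (1, 0) C (0, x) = 0 ∧
      2 * dirDeriv (1, 0) Y (0, x) + dirDeriv (1, 0) (dirDeriv (1, 0) C) (0, x) = 0 ∧
      3 * dirDeriv (1, 0) (dirDeriv (1, 0) Y) (0, x) +
        dirDeriv (1, 0) (dirDeriv (1, 0) (dirDeriv (1, 0) C)) (0, x) = 0 := by
  set Z : ℂ × ℂ → ℂ := Prod.fst with hZdef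
  have hZ : AnalyticAt ℂ Z 0 := analyticAt_fst
  have hDZ : ∀ p, dirDeriv (1, 0) Z p = 1 := by
    intro p; simp [dirDeriv, Z, fderiv_fst]
  -- Differentiating `z Y + C` in `z` gives `z ∂Y + (Y + ∂C)`, an expression of the same shape, so
  -- the step can be iterated.
  have step : ∀ {Y C U : ℂ × ℂ → ℂ}, AnalyticAt ℂ Y 0 → AnalyticAt ℂ C 0 →
      U =ᶠ[𝓝 0] Z * Y + C →
      dirDeriv (1, 0) U =ᶠ[𝓝 0] Z * dirDeriv (1, 0) Y + (Y + dirDeriv (1, 0) C) := by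
    intro Y C U hY hC hU
    refine (dirDeriv_congr hU _).trans ((dirDeriv_add (hZ.mul hY) hC _).trans ?_)
    filter_upwards [dirDeriv_mul hZ hY (1, 0)] with p hp
    simp only [Pi.add_apply, hp, Pi.mul_apply, hDZ]
    ring
  have h0 : (fun _ => (0 : ℂ)) =ᶠ[𝓝 0] Z * Y + C := by
    filter_upwards [h] with p hp using hp.symm
  have hd0 : dirDeriv (1, 0) (fun _ => (0 : ℂ)) = fun _ => (0 : ℂ) := by
    funext p; simp [dirDeriv]
  have h1 := step hY hC h0
  rw [hd0] at h1
  have h2 := step (hY.dirDeriv _) (hY.add (hC.dirDeriv _)) h1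
  rw [hd0] at h2
  have h3 := step ((hY.dirDeriv _).dirDeriv _)
    ((hY.dirDeriv _).add ((hY.add (hC.dirDeriv _)).dirDeriv _)) h2
  rw [hd0] at h3
  have e1 := dirDeriv_add hY (hC.dirDeriv (1, 0)) (1, 0)
  have e2 := dirDeriv_add (hY.dirDeriv (1, 0)) ((hY.add (hC.dirDeriv (1, 0))).dirDeriv (1, 0))
    (1, 0)
  have e3 := (dirDeriv_congr e1 (1, 0)).trans
    (dirDeriv_add (hY.dirDeriv (1, 0)) ((hC.dirDeriv (1, 0)).dirDeriv (1, 0)) (1, 0))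
  filter_upwards [eventually_slice h1, eventually_slice h2, eventually_slice h3,
    eventually_slice e1, eventually_slice e2, eventually_slice e3] with x h1 h2 h3 e1 e2 e3
  simp only [Pi.add_apply, Pi.mul_apply, Z, zero_mul, zero_add] at h1 h2 h3 e1 e2 e3
  rw [e1] at h2
  rw [e2, e3] at h3
  exact ⟨h1.symm, by linear_combination -h2, by linear_combination -h3⟩

/-- The coefficients of `z`, `z²` and `z³` in the equation
`z ∂ₓ b - z² ∂_z a + z a + [a, b] = 0`. -/
theorem taylor_of_flat {a b : Fin 2 → Fin 2 → ℂ × ℂ → ℂ}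
    (ha : ∀ i j, AnalyticAt ℂ (a i j) 0) (hb : ∀ i j, AnalyticAt ℂ (b i j) 0) (i j : Fin 2)
    (h : ∀ᶠ p in 𝓝 (0 : ℂ × ℂ), p.1 * dirDeriv (0, 1) (b i j) p
      - p.1 ^ 2 * dirDeriv (1, 0) (a i j) p + p.1 * a i j p + commEntry a b i j p = 0) :
    ∀ᶠ x in 𝓝 (0 : ℂ),
      dirDeriv (0, 1) (b i j) (0, x) + a i j (0, x)
        + commEntry (entryDeriv (1, 0) a) b i j (0, x)
        + commEntry a (entryDeriv (1, 0) b) i j (0, x) = 0 ∧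
      2 * dirDeriv (0, 1) (entryDeriv (1, 0) b i j) (0, x)
        + commEntry (entryDeriv (1, 0) (entryDeriv (1, 0) a)) b i j (0, x)
        + 2 * commEntry (entryDeriv (1, 0) a) (entryDeriv (1, 0) b) i j (0, x)
        + commEntry a (entryDeriv (1, 0) (entryDeriv (1, 0) b)) i j (0, x) = 0 ∧
      3 * (dirDeriv (0, 1) (entryDeriv (1, 0) (entryDeriv (1, 0) b) i j) (0, x)
          - entryDeriv (1, 0) (entryDeriv (1, 0) a) i j (0, x))
        + commEntry (entryDeriv (1, 0) (entryDeriv (1, 0) (entryDeriv (1, 0) a))) b i j (0, x)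
        + 3 * commEntry (entryDeriv (1, 0) (entryDeriv (1, 0) a)) (entryDeriv (1, 0) b) i j (0, x)
        + 3 * commEntry (entryDeriv (1, 0) a) (entryDeriv (1, 0) (entryDeriv (1, 0) b)) i j (0, x)
        + commEntry a (entryDeriv (1, 0) (entryDeriv (1, 0) (entryDeriv (1, 0) b))) i j (0, x)
        = 0 := by
  have hZ : AnalyticAt ℂ (Prod.fst : ℂ × ℂ → ℂ) 0 := analyticAt_fst
  have hDZ : ∀ p, dirDeriv (1, 0) (Prod.fst : ℂ × ℂ → ℂ) p = 1 := by
    intro p; simp [dirDeriv, fderiv_fst]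
  have ha1 : ∀ i j, AnalyticAt ℂ (entryDeriv (1, 0) a i j) 0 := fun i j => (ha i j).dirDeriv _
  have ha2 : ∀ i j, AnalyticAt ℂ (entryDeriv (1, 0) (entryDeriv (1, 0) a) i j) 0 :=
    fun i j => (ha1 i j).dirDeriv _
  have hb1 : ∀ i j, AnalyticAt ℂ (entryDeriv (1, 0) b i j) 0 := fun i j => (hb i j).dirDeriv _
  have hb2 : ∀ i j, AnalyticAt ℂ (entryDeriv (1, 0) (entryDeriv (1, 0) b) i j) 0 :=
    fun i j => (hb1 i j).dirDeriv _
  have hZa := hZ.mul (ha1 i j)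
  have hY1 := (hb i j).dirDeriv (0, 1)
  have hY := (hY1.sub hZa).add (ha i j)
  have key := taylor_of_fst_mul_add hY (AnalyticAt.commEntry ha hb i j) (by
    filter_upwards [h] with p hp
    refine Eq.trans ?_ hp
    simp only [Pi.add_apply, Pi.sub_apply, Pi.mul_apply, entryDeriv]
    ring)
  have c1 := dirDeriv_commEntry ha hb (1, 0) i j
  have c2 := (dirDeriv_congr c1 (1, 0)).trans (dirDeriv_add (AnalyticAt.commEntry ha1 hb i j)
    (AnalyticAt.commEntry ha hb1 i j) (1, 0))
  have c20 := dirDeriv_commEntry ha1 hb (1, 0) i j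
  have c11 := dirDeriv_commEntry ha hb1 (1, 0) i j
  have c3 := (dirDeriv_congr c2 (1, 0)).trans
    (dirDeriv_add ((AnalyticAt.commEntry ha1 hb i j).dirDeriv (1, 0))
      ((AnalyticAt.commEntry ha hb1 i j).dirDeriv (1, 0)) (1, 0))
  have c3a := (dirDeriv_congr c20 (1, 0)).trans
    (dirDeriv_add (AnalyticAt.commEntry ha2 hb i j) (AnalyticAt.commEntry ha1 hb1 i j) (1, 0))
  have c3b := (dirDeriv_congr c11 (1, 0)).trans
    (dirDeriv_add (AnalyticAt.commEntry ha1 hb1 i j) (AnalyticAt.commEntry ha hb2 i j) (1, 0))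
  have c30 := dirDeriv_commEntry ha2 hb (1, 0) i j
  have c21 := dirDeriv_commEntry ha1 hb1 (1, 0) i j
  have c12 := dirDeriv_commEntry ha hb2 (1, 0) i j
  -- The `z`-derivative of `z a` cancels against that of `z² ∂_z a` at this order, which is why the
  -- first `z`-derivative of `a` appears in the `z²` coefficient only inside commutators.
  have y1 : dirDeriv (1, 0) (dirDeriv (0, 1) (b i j) - Prod.fst * entryDeriv (1, 0) a i j + a i j)
      =ᶠ[𝓝 0] dirDeriv (0, 1) (entryDeriv (1, 0) b i j)
        - Prod.fst * entryDeriv (1, 0) (entryDeriv (1, 0) a) i j := by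
    filter_upwards [dirDeriv_add (hY1.sub hZa) (ha i j) (1, 0), dirDeriv_sub hY1 hZa (1, 0),
      dirDeriv_mul hZ (ha1 i j) (1, 0), dirDeriv_comm (hb i j) (1, 0) (0, 1)] with p h1 h2 h3 h4
    rw [h1, Pi.add_apply, h2, Pi.sub_apply, h3, h4]
    simp only [Pi.add_apply, Pi.sub_apply, Pi.mul_apply, hDZ, entryDeriv]
    ring
  have y2 := (dirDeriv_congr y1 (1, 0)).trans
    (dirDeriv_sub ((hb1 i j).dirDeriv (0, 1)) (hZ.mul (ha2 i j)) (1, 0))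
  filter_upwards [key, eventually_slice c1, eventually_slice c2, eventually_slice c3,
    eventually_slice c20, eventually_slice c11, eventually_slice c3a, eventually_slice c3b,
    eventually_slice c30, eventually_slice c21, eventually_slice c12,
    eventually_slice y1, eventually_slice y2,
    eventually_slice (dirDeriv_mul hZ (ha2 i j) (1, 0)),
    eventually_slice (dirDeriv_comm (hb1 i j) (1, 0) (0, 1))]
    with x hk c1 c2 c3 c20 c11 c3a c3b c30 c21 c12 y1 y2 y3 y4
  obtain ⟨k1, k2, k3⟩ := hk
  rw [c1] at k1
  rw [c2, y1] at k2
  rw [c3, y2] at k3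
  simp only [Pi.add_apply, Pi.sub_apply, Pi.mul_apply, zero_mul, sub_zero, hDZ, one_mul, c20, c11,
    c3a, c3b, c30, c21, c12, y3, y4] at k1 k2 k3
  refine ⟨by linear_combination k1, by linear_combination k2, ?_⟩
  have e : dirDeriv (0, 1) (dirDeriv (1, 0) (entryDeriv (1, 0) b i j)) (0, x)
      = dirDeriv (0, 1) (entryDeriv (1, 0) (entryDeriv (1, 0) b) i j) (0, x) := rfl
  linear_combination k3 - 3 * e

/-! ### Pointwise algebra of the flatness equations in rank two -/

section TwoByTwo

variable {N N' P B B' W Q X : Matrix (Fin 2) (Fin 2) ℂ} {g g' d h h' : ℂ}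

/-- Multiply the `z` equation by `B` and the `z²` equation by `N` and take traces: `tr([N, B] B)`
and `tr(N [N, W])` vanish, and the two terms with `P` cancel by cyclicity. -/
theorem mul_trace_deriv_of_flat
    (h1 : (1 - g') • N - g • N' - g • (P * N - N * P) + (N * B - B * N) = 0)
    (h2 : B' + (P * B - B * P) + (N * W - W * N) = 0) :
    g * ((N' * B).trace + (N * B').trace) = (1 - g') * (N * B).trace := by
  have e1 : ((1 - g') • N - g • N' - g • (P * N - N * P) + (N * B - B * N)) * B = 0 := by
    rw [h1, zero_mul]
  have e2 : N * (B' + (P * B - B * P) + (N * W - W * N)) = 0 := by rw [h2, mul_zero]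
  have t1 := congrArg Matrix.trace e1
  have t2 := congrArg Matrix.trace e2
  simp only [Matrix.trace_fin_two, Matrix.mul_apply, Fin.sum_univ_two, Matrix.add_apply,
    Matrix.sub_apply, Matrix.smul_apply, smul_eq_mul, Matrix.zero_apply] at t1 t2 ⊢
  linear_combination -t1 + g * t2

/-- Trace and determinant vanish; this lets the second row of `N` be eliminated in later entrywise
computations. -/
theorem nilpotent_two_entries (hN : N * N = 0) (h01 : N 0 1 ≠ 0) :
    N 1 1 = -N 0 0 ∧ N 0 0 ^ 2 + N 0 1 * N 1 0 = 0 := by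
  have e0 := congrFun (congrFun hN 0) 0
  have e1 := congrFun (congrFun hN 0) 1
  simp only [Matrix.mul_apply, Fin.sum_univ_two, Matrix.zero_apply] at e0 e1
  refine ⟨?_, by linear_combination e0⟩
  have : N 0 1 * (N 0 0 + N 1 1) = 0 := by linear_combination e1
  linear_combination (mul_eq_zero.1 this).resolve_left h01

/-- Write the rank one matrix `N` as `v ⊗ ℓ` with `ℓ(v) = 0`. Then `tr(N B) = ℓ(B v) = 0` says that
`B` preserves the line `ker ℓ` spanned by `v`, so both `N B` and `B N` are multiples of `N`. The
factor is read off at the entry `(0, 1)`. -/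
theorem commutator_eq_smul_of_trace_mul_eq_zero (hN : N * N = 0) (h01 : N 0 1 ≠ 0)
    (hB : (N * B).trace = 0) :
    N * B - B * N = ((N * B - B * N) 0 1 / N 0 1) • N := by
  obtain ⟨h11, hsq⟩ := nilpotent_two_entries hN h01
  have h10 : N 1 0 = -(N 0 0 ^ 2) / N 0 1 := by
    rw [eq_div_iff h01]; linear_combination hsq
  simp only [Matrix.trace_fin_two, Matrix.mul_apply, Fin.sum_univ_two] at hB
  rw [h11, h10] at hB
  have hB' : B 1 0 = (N 0 0 ^ 2 * B 0 1 / N 0 1 - N 0 0 * (B 0 0 - B 1 1)) / N 0 1 := by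
    rw [eq_div_iff h01]; linear_combination hB
  ext i j
  fin_cases i <;> fin_cases j <;>
    simp [Matrix.mul_apply, Fin.sum_univ_two, h11, h10, hB'] <;> field_simp <;> ring

/-- This holds for any matrix of rank one: if `N = v ⊗ ℓ`, then `N W N = ℓ(W v) N`. -/
theorem nilpotent_mul_mul (hN : N * N = 0) (h01 : N 0 1 ≠ 0) :
    N * W * N = (N * W).trace • N := by
  obtain ⟨h11, hsq⟩ := nilpotent_two_entries hN h01
  have h10 : N 1 0 = -(N 0 0 ^ 2) / N 0 1 := by
    rw [eq_div_iff h01]; linear_combination hsq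
  ext i j
  fin_cases i <;> fin_cases j <;>
    simp [Matrix.mul_apply, Fin.sum_univ_two, Matrix.trace_fin_two, h11, h10] <;>
    field_simp <;> ring

/-- Apply the derivation `∂ₓ + ad P` to `[N, B] = -h N`. It sends `N` to `d N` and `B` to `-[N, W]`,
and `[N, [N, W]] = -2 N W N` because `N² = 0`. The terms with `d` cancel. The hypothesis `hd` is the
entry `(0, 1)` of the differentiated relation. -/
theorem deriv_eigenvalue_of_flat (hN : N * N = 0) (h01 : N 0 1 ≠ 0)
    (hD : N' + (P * N - N * P) = d • N)
    (h2 : B' + (P * B - B * P) + (N * W - W * N) = 0) (hc : N * B - B * N = -h • N)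
    (hd : h' * N 0 1 + h * N' 0 1 = -(N' * B + N * B' - (B' * N + B * N')) 0 1) :
    h' = -2 * (N * W).trace := by
  have eN : N' = d • N - (P * N - N * P) := by rw [← hD]; abel
  have eB : B' = -(P * B - B * P) - (N * W - W * N) := by
    rw [← sub_eq_zero, ← h2]; abel
  have key : N' * B + N * B' - (B' * N + B * N')
      = d • (N * B - B * N) - (P * (N * B - B * N) - (N * B - B * N) * P)
        + (2 : ℂ) • (N * W * N) - (N * N * W + W * (N * N)) := by
    rw [eN, eB, two_smul]
    simp only [mul_sub, sub_mul, mul_neg, neg_mul, smul_mul_assoc,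
      mul_smul_comm, smul_sub, mul_assoc]
    abel
  rw [hN, hc, nilpotent_mul_mul hN h01] at key
  rw [key, eN] at hd
  simp only [zero_mul, mul_zero, smul_mul_assoc, mul_smul_comm, Matrix.add_apply,
    Matrix.sub_apply, Matrix.smul_apply, smul_eq_mul, Matrix.zero_apply] at hd
  have : (h' + 2 * (N * W).trace) * N 0 1 = 0 := by linear_combination hd
  linear_combination (mul_eq_zero.1 this).resolve_right h01

/-- Here `X` stands for `B₂`, `W` for its derivative, and `B'` for an arbitrary matrix, which
disappears since `tr(N [N, B']) = 0`. The `P` terms combine to `d tr(N X)`, and `tr(N [Q, B]) =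
-tr([N, B] Q) = h tr(N Q)`. -/
theorem deriv_trace_of_flat (hD : N' + (P * N - N * P) = d • N)
    (h3 : W - Q + (P * X - X * P) + (Q * B - B * Q) + (N * B' - B' * N) = 0)
    (hc : N * B - B * N = -h • N) :
    (N' * X).trace + (N * W).trace = d * (N * X).trace + (1 - h) * (N * Q).trace := by
  have e1 := congrArg (fun M => (M * X).trace) hD
  have e3 := congrArg (fun M => (N * M).trace) h3
  have e4 := congrArg (fun M => (M * Q).trace) hc
  simp only [Matrix.trace_fin_two, Matrix.mul_apply, Fin.sum_univ_two, Matrix.add_apply,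
    Matrix.sub_apply, Matrix.smul_apply, smul_eq_mul, Matrix.zero_apply]
    at e1 e3 e4 ⊢
  linear_combination e1 + e3 + e4

end TwoByTwo

/-! ### The differential equation for the coefficient of the Euler field -/

/-- The matrix of values of a matrix of functions. -/
def evalMat (n : Fin 2 → Fin 2 → ℂ → ℂ) (x : ℂ) : Matrix (Fin 2) (Fin 2) ℂ :=
  Matrix.of fun i j => n i j x

/-- The matrix of derivatives of a matrix of functions. -/
def derivMat (n : Fin 2 → Fin 2 → ℂ → ℂ) (x : ℂ) : Matrix (Fin 2) (Fin 2) ℂ :=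
  Matrix.of fun i j => deriv (n i j) x

section

variable {n m p q b c : Fin 2 → Fin 2 → ℂ → ℂ} {g : ℂ → ℂ}

theorem analyticAt_trace_mul {x : ℂ} (hn : ∀ i j, AnalyticAt ℂ (n i j) x)
    (hm : ∀ i j, AnalyticAt ℂ (m i j) x) :
    AnalyticAt ℂ (fun x => (evalMat n x * evalMat m x).trace) x := by
  simp only [Matrix.trace_fin_two, Matrix.mul_apply, Fin.sum_univ_two, evalMat, Matrix.of_apply]
  have := hn 0 0; have := hn 0 1; have := hn 1 0; have := hn 1 1
  have := hm 0 0; have := hm 0 1; have := hm 1 0; have := hm 1 1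
  fun_prop

theorem deriv_trace_mul {x : ℂ} (hn : ∀ i j, AnalyticAt ℂ (n i j) x)
    (hm : ∀ i j, AnalyticAt ℂ (m i j) x) :
    deriv (fun x => (evalMat n x * evalMat m x).trace) x
      = (derivMat n x * evalMat m x).trace + (evalMat n x * derivMat m x).trace := by
  simp only [Matrix.trace_fin_two, Matrix.mul_apply, Fin.sum_univ_two, evalMat, derivMat,
    Matrix.of_apply]
  have hN := fun i j => (hn i j).differentiableAt.hasDerivAt
  have hM := fun i j => (hm i j).differentiableAt.hasDerivAt
  refine HasDerivAt.deriv (((((hN 0 0).mul (hM 0 0)).add ((hN 0 1).mul (hM 1 0))).add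
    (((hN 1 0).mul (hM 0 1)).add ((hN 1 1).mul (hM 1 1)))).congr_deriv ?_)
  ring

theorem analyticAt_commutator_entry {x : ℂ} (hn : ∀ i j, AnalyticAt ℂ (n i j) x)
    (hm : ∀ i j, AnalyticAt ℂ (m i j) x) (i j : Fin 2) :
    AnalyticAt ℂ (fun x => (evalMat n x * evalMat m x - evalMat m x * evalMat n x) i j) x := by
  simp only [Matrix.sub_apply, Matrix.mul_apply, Fin.sum_univ_two, evalMat, Matrix.of_apply]
  have := hn i 0; have := hn i 1; have := hn 0 j; have := hn 1 j
  have := hm i 0; have := hm i 1; have := hm 0 j; have := hm 1 j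
  fun_prop

theorem deriv_commutator_entry {x : ℂ} (hn : ∀ i j, AnalyticAt ℂ (n i j) x)
    (hm : ∀ i j, AnalyticAt ℂ (m i j) x) (i j : Fin 2) :
    deriv (fun x => (evalMat n x * evalMat m x - evalMat m x * evalMat n x) i j) x
      = (derivMat n x * evalMat m x + evalMat n x * derivMat m x
        - (derivMat m x * evalMat n x + evalMat m x * derivMat n x)) i j := by
  simp only [Matrix.sub_apply, Matrix.add_apply, Matrix.mul_apply, Fin.sum_univ_two, evalMat,
    derivMat, Matrix.of_apply]
  have hN := fun i j => (hn i j).differentiableAt.hasDerivAt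
  have hM := fun i j => (hm i j).differentiableAt.hasDerivAt
  refine HasDerivAt.deriv (((((hN i 0).mul (hM 0 j)).add ((hN i 1).mul (hM 1 j))).sub
    (((hM i 0).mul (hN 0 j)).add ((hM i 1).mul (hN 1 j)))).congr_deriv ?_)
  ring

/-- The coefficient `g` of the Euler field of a flat structure satisfies a linear differential
equation of order three, if it vanishes to second order. -/
theorem exists_third_order_of_flat (hn : ∀ i j, AnalyticAt ℂ (n i j) 0)
    (hp : ∀ i j, AnalyticAt ℂ (p i j) 0) (hq : ∀ i j, AnalyticAt ℂ (q i j) 0)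
    (hb : ∀ i j, AnalyticAt ℂ (b i j) 0) (hc : ∀ i j, AnalyticAt ℂ (c i j) 0)
    (hg : AnalyticAt ℂ g 0) (hg0 : g 0 = 0) (hg1 : deriv g 0 = 0)
    (hgne : ∀ᶠ x in 𝓝[≠] 0, g x ≠ 0) (h01 : n 0 1 0 ≠ 0)
    (hN : ∀ᶠ x in 𝓝 0, evalMat n x * evalMat n x = 0)
    (h1 : ∀ᶠ x in 𝓝 0, (1 - deriv g x) • evalMat n x - g x • derivMat n x
      - g x • (evalMat p x * evalMat n x - evalMat n x * evalMat p x)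
      + (evalMat n x * evalMat b x - evalMat b x * evalMat n x) = 0)
    (h2 : ∀ᶠ x in 𝓝 0, derivMat b x + (evalMat p x * evalMat b x - evalMat b x * evalMat p x)
      + (evalMat n x * (evalMat c x + g x • evalMat q x)
        - (evalMat c x + g x • evalMat q x) * evalMat n x) = 0)
    (h3 : ∀ᶠ x in 𝓝 0, ∃ X : Matrix (Fin 2) (Fin 2) ℂ, derivMat c x - evalMat q x
      + (evalMat p x * evalMat c x - evalMat c x * evalMat p x)
      + (evalMat q x * evalMat b x - evalMat b x * evalMat q x)
      + (evalMat n x * X - X * evalMat n x) = 0) :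
    ∃ u v : ℂ → ℂ, AnalyticAt ℂ u 0 ∧ AnalyticAt ℂ v 0 ∧
      ∀ᶠ x in 𝓝 0, deriv (deriv (deriv g)) x = deriv g x * u x + g x * v x := by
  have evn : ∀ᶠ x in 𝓝 (0 : ℂ), ∀ i j, AnalyticAt ℂ (n i j) x :=
    Filter.eventually_all.2 fun i => Filter.eventually_all.2 fun j => (hn i j).eventually_analyticAt
  have evb : ∀ᶠ x in 𝓝 (0 : ℂ), ∀ i j, AnalyticAt ℂ (b i j) x :=
    Filter.eventually_all.2 fun i => Filter.eventually_all.2 fun j => (hb i j).eventually_analyticAt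
  have evc : ∀ᶠ x in 𝓝 (0 : ℂ), ∀ i j, AnalyticAt ℂ (c i j) x :=
    Filter.eventually_all.2 fun i => Filter.eventually_all.2 fun j => (hc i j).eventually_analyticAt
  have evn01 : ∀ᶠ x in 𝓝 (0 : ℂ), n 0 1 x ≠ 0 := (hn 0 1).continuousAt.eventually_ne h01
  -- the trace of `N B₁`
  have hβ : ∀ᶠ x in 𝓝 0, (evalMat n x * evalMat b x).trace = 0 := by
    refine eventually_zero_of_mul_deriv_eq hg (analyticAt_trace_mul hn hb) hg0 hg1 ?_
    filter_upwards [h1, h2, evn, evb] with x h1 h2 hn hb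
    rw [deriv_trace_mul hn hb]
    exact mul_trace_deriv_of_flat h1 h2
  -- the eigenvalue `h` of `B₁` and the coefficient `d` of the derivative of `N`
  set h : ℂ → ℂ := fun x =>
    -((evalMat n x * evalMat b x - evalMat b x * evalMat n x) 0 1 / n 0 1 x) with hdef
  -- Defined through the entry `(0, 1)`, where `n 0 1` is invertible, so that `d` is holomorphic at
  -- `0` even though the matrix identity `hD` is first obtained only where `g ≠ 0`.
  set d : ℂ → ℂ := fun x =>
    (deriv (n 0 1) x + (evalMat p x * evalMat n x - evalMat n x * evalMat p x) 0 1) / n 0 1 x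
    with ddef
  have hd : AnalyticAt ℂ d 0 :=
    ((hn 0 1).deriv.add (analyticAt_commutator_entry hp hn 0 1)).div (hn 0 1) h01
  have hh : AnalyticAt ℂ h 0 := ((analyticAt_commutator_entry hn hb 0 1).div (hn 0 1) h01).neg
  have hcomm : ∀ᶠ x in 𝓝 0, evalMat n x * evalMat b x - evalMat b x * evalMat n x
      = -h x • evalMat n x := by
    filter_upwards [hN, evn01, hβ] with x hN h01 hβ
    have := commutator_eq_smul_of_trace_mul_eq_zero hN h01 hβ
    rw [hdef, neg_neg]
    exact this
  have hhd : h =ᶠ[𝓝 0] fun x => 1 - deriv g x - g x * d x := by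
    filter_upwards [h1, evn01] with x h1 h01
    have e := congrFun (congrFun h1 0) 1
    simp only [hdef, ddef]
    rw [Matrix.add_apply, Matrix.sub_apply, Matrix.sub_apply, Matrix.smul_apply,
      Matrix.smul_apply, Matrix.smul_apply, Matrix.zero_apply] at e
    simp only [smul_eq_mul] at e
    have e2 : evalMat n x 0 1 = n 0 1 x := rfl
    have e3 : derivMat n x 0 1 = deriv (n 0 1) x := rfl
    rw [e2, e3] at e
    field_simp
    linear_combination -e
  have hD : ∀ᶠ x in 𝓝[≠] 0, derivMat n x
      + (evalMat p x * evalMat n x - evalMat n x * evalMat p x) = d x • evalMat n x := by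
    filter_upwards [h1.filter_mono nhdsWithin_le_nhds, hcomm.filter_mono nhdsWithin_le_nhds,
      hhd.filter_mono nhdsWithin_le_nhds, hgne] with x h1 hcomm hhd hgx
    have e : g x • (derivMat n x
        + (evalMat p x * evalMat n x - evalMat n x * evalMat p x)) = g x • d x • evalMat n x := by
      rw [hcomm, hhd] at h1
      rw [smul_add, ← sub_eq_zero, ← neg_eq_zero, ← h1, smul_smul]
      module
    exact smul_right_injective _ hgx e
  have hdn : ∀ᶠ x in 𝓝 0, deriv h x * n 0 1 x + h x * deriv (n 0 1) x
      = -(derivMat n x * evalMat b x + evalMat n x * derivMat b x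
        - (derivMat b x * evalMat n x + evalMat b x * derivMat n x)) 0 1 := by
    have e : (fun x => h x * n 0 1 x) =ᶠ[𝓝 0]
        fun x => -(evalMat n x * evalMat b x - evalMat b x * evalMat n x) 0 1 := by
      filter_upwards [evn01] with x h01
      simp only [hdef]
      field_simp
    filter_upwards [e.deriv, hh.eventually_analyticAt, evn, evb] with x e hh hn hb
    rw [← deriv_commutator_entry hn hb, ← deriv.fun_neg, ← e]
    exact (hh.differentiableAt.hasDerivAt.mul (hn 0 1).differentiableAt.hasDerivAt).deriv.symm
  set κ : ℂ → ℂ := fun x => (evalMat n x * evalMat q x).trace with κdef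
  set β : ℂ → ℂ := fun x => (evalMat n x * evalMat c x).trace with βdef
  have hκ : AnalyticAt ℂ κ 0 := analyticAt_trace_mul hn hq
  have hβa : AnalyticAt ℂ β 0 := analyticAt_trace_mul hn hc
  have hh' : ∀ᶠ x in 𝓝[≠] 0, deriv h x = -2 * (β x + g x * κ x) := by
    filter_upwards [hN.filter_mono nhdsWithin_le_nhds, evn01.filter_mono nhdsWithin_le_nhds, hD,
      h2.filter_mono nhdsWithin_le_nhds, hcomm.filter_mono nhdsWithin_le_nhds,
      hdn.filter_mono nhdsWithin_le_nhds] with x hN h01 hD h2 hcomm hdn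
    have := deriv_eigenvalue_of_flat (h' := deriv h x) hN h01 hD h2 hcomm hdn
    rw [this, mul_add, Matrix.trace_add, Matrix.mul_smul, Matrix.trace_smul, smul_eq_mul]
  -- The identity theorem carries the relation across the zero of `g`, so that it can be
  -- differentiated.
  have hh'' : deriv h =ᶠ[𝓝 0] fun x => -2 * (β x + g x * κ x) :=
    (hh.deriv.frequently_eq_iff_eventually_eq
      (analyticAt_const.mul (hβa.add (hg.mul hκ)))).1 hh'.frequently
  have hβ' : ∀ᶠ x in 𝓝[≠] 0, deriv β x = d x * β x + (1 - h x) * κ x := by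
    filter_upwards [hD, h3.filter_mono nhdsWithin_le_nhds,
      hcomm.filter_mono nhdsWithin_le_nhds, evn.filter_mono nhdsWithin_le_nhds,
      evc.filter_mono nhdsWithin_le_nhds] with x hD h3 hcomm hn hc
    obtain ⟨X, h3⟩ := h3
    rw [βdef, deriv_trace_mul hn hc]
    exact deriv_trace_of_flat hD h3 hcomm
  have hd1 : deriv h =ᶠ[𝓝 0] fun x =>
      -deriv (deriv g) x - (deriv g x * d x + g x * deriv d x) := by
    refine hhd.deriv.trans ?_
    filter_upwards [hg.eventually_analyticAt, hd.eventually_analyticAt] with x hg hd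
    refine HasDerivAt.deriv ((((hasDerivAt_const x (1 : ℂ)).sub
      hg.deriv.differentiableAt.hasDerivAt).sub
      (hg.differentiableAt.hasDerivAt.mul hd.differentiableAt.hasDerivAt)).congr_deriv ?_)
    ring
  -- Equate the two expressions for `h''`, coming from `h = 1 - g' - g d` and from `h' = -2(β +
  -- gκ)`. Replace `β'` by `dβ + (1 - h)κ` and `-2β` by `h' + 2gκ`; the terms with `g''` cancel.
  refine ⟨fun x => d x ^ 2 + 4 * κ x - 2 * deriv d x,
    fun x => d x * deriv d x + 2 * deriv κ x - deriv (deriv d) x, ?_, ?_, ?_⟩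
  · have := hd.deriv
    fun_prop
  · have := hd.deriv
    have := hd.deriv.deriv
    have := hκ.deriv
    fun_prop
  · refine (AnalyticAt.frequently_eq_iff_eventually_eq hg.deriv.deriv.deriv ?_).1
      (Filter.Eventually.frequently ?_)
    · have := hd.deriv
      have := hd.deriv.deriv
      have := hκ.deriv
      have := hg.deriv
      fun_prop
    filter_upwards [hhd.filter_mono nhdsWithin_le_nhds, hh', hβ',
      hh''.deriv.filter_mono nhdsWithin_le_nhds, hd1.filter_mono nhdsWithin_le_nhds,
      hd1.deriv.filter_mono nhdsWithin_le_nhds,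
      hg.eventually_analyticAt.filter_mono nhdsWithin_le_nhds,
      hd.eventually_analyticAt.filter_mono nhdsWithin_le_nhds,
      hκ.eventually_analyticAt.filter_mono nhdsWithin_le_nhds,
      hβa.eventually_analyticAt.filter_mono nhdsWithin_le_nhds]
      with x ehd e1 e2 e3 e4 e5 hg hd hκ hβ
    have e6 : deriv (deriv h) x = -2 * (deriv β x + (deriv g x * κ x + g x * deriv κ x)) := by
      rw [e3]
      exact ((hβ.differentiableAt.hasDerivAt.add (hg.differentiableAt.hasDerivAt.mul
        hκ.differentiableAt.hasDerivAt)).const_mul (-2)).deriv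
    have e7 : deriv (deriv h) x = -deriv (deriv (deriv g)) x
        - ((deriv (deriv g) x * d x + deriv g x * deriv d x)
          + (deriv g x * deriv d x + g x * deriv (deriv d) x)) := by
      rw [e5]
      exact (hg.deriv.deriv.differentiableAt.hasDerivAt.neg.sub
        ((hg.deriv.differentiableAt.hasDerivAt.mul hd.differentiableAt.hasDerivAt).add
        (hg.differentiableAt.hasDerivAt.mul hd.deriv.differentiableAt.hasDerivAt))).deriv
    rw [e2] at e6
    rw [e4] at e1
    rw [ehd] at e6
    clear_value d
    linear_combination e7 - e6 + d x * e1

/-- A function `g` vanishing to second order which occurs in a flat structure is zero or vanishes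
to order exactly two with vanishing third derivative. -/
theorem second_order_zero_of_flat (hn : ∀ i j, AnalyticAt ℂ (n i j) 0)
    (hp : ∀ i j, AnalyticAt ℂ (p i j) 0) (hq : ∀ i j, AnalyticAt ℂ (q i j) 0)
    (hb : ∀ i j, AnalyticAt ℂ (b i j) 0) (hc : ∀ i j, AnalyticAt ℂ (c i j) 0)
    (hg : AnalyticAt ℂ g 0) (hg0 : g 0 = 0) (hg1 : deriv g 0 = 0) (h01 : n 0 1 0 ≠ 0)
    (hN : ∀ᶠ x in 𝓝 0, evalMat n x * evalMat n x = 0)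
    (h1 : ∀ᶠ x in 𝓝 0, (1 - deriv g x) • evalMat n x - g x • derivMat n x
      - g x • (evalMat p x * evalMat n x - evalMat n x * evalMat p x)
      + (evalMat n x * evalMat b x - evalMat b x * evalMat n x) = 0)
    (h2 : ∀ᶠ x in 𝓝 0, derivMat b x + (evalMat p x * evalMat b x - evalMat b x * evalMat p x)
      + (evalMat n x * (evalMat c x + g x • evalMat q x)
        - (evalMat c x + g x • evalMat q x) * evalMat n x) = 0)
    (h3 : ∀ᶠ x in 𝓝 0, ∃ X : Matrix (Fin 2) (Fin 2) ℂ, derivMat c x - evalMat q x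
      + (evalMat p x * evalMat c x - evalMat c x * evalMat p x)
      + (evalMat q x * evalMat b x - evalMat b x * evalMat q x)
      + (evalMat n x * X - X * evalMat n x) = 0) :
    (∀ᶠ x in 𝓝 0, g x = 0) ∨
      (deriv (deriv g) 0 ≠ 0 ∧ deriv (deriv (deriv g)) 0 = 0) := by
  rcases hg.eventually_eq_zero_or_eventually_ne_zero with hz | hne
  · exact Or.inl hz
  obtain ⟨u, v, hu, hv, huv⟩ :=
    exists_third_order_of_flat hn hp hq hb hc hg hg0 hg1 hne h01 hN h1 h2 h3
  by_cases hg2 : deriv (deriv g) 0 = 0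
  · exact Or.inl (eventually_zero_of_third_order hg hu hv hg0 hg1 hg2 huv)
  · exact Or.inr ⟨hg2, by rw [huv.self_of_nhds, hg0, hg1]; simp⟩

end

/-! ### Structures over `𝓝₂`: the necessary condition -/

/-- The condition on the `3`-jet and the germ of `g` which characterizes the Euler fields
`(t₁ + c) ∂₁ + g(t₂) ∂₂` with a listed normal form. -/
def N2.HasListedJet (g : ℂ → ℂ) : Prop :=
  (∀ᶠ x in 𝓝 0, g x = 0) ∨ g 0 ≠ 0 ∨ deriv g 0 ≠ 0 ∨
    (deriv (deriv g) 0 ≠ 0 ∧ deriv (deriv (deriv g)) 0 = 0)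

/-- At `z = 0` the scalar part of `b` drops out of every commutator, leaving `[f, b] = -g [f, a]`.
-/
theorem commEntry_smul_left {a b : Fin 2 → Fin 2 → ℂ × ℂ → ℂ} {p : ℂ × ℂ} {c g : ℂ}
    (hB : ∀ i j, b i j p = -c * (1 : Matrix (Fin 2) (Fin 2) ℂ) i j - g * a i j p)
    (f : Fin 2 → Fin 2 → ℂ × ℂ → ℂ) (i j : Fin 2) :
    commEntry f b i j p = -g * commEntry f a i j p := by
  simp only [commEntry, Pi.sub_apply, Pi.add_apply, Pi.mul_apply, hB, Matrix.one_apply]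
  fin_cases i <;> fin_cases j <;> norm_num <;> ring

/-- Translates the flat connection into the relations between Taylor coefficients in `z` required by
`second_order_zero_of_flat`. -/
theorem second_order_zero_of_flat_of_ne {a b : Fin 2 → Fin 2 → ℂ × ℂ → ℂ} {g : ℂ → ℂ} {c : ℂ}
    (ha : ∀ i j, AnalyticAt ℂ (a i j) 0) (hb : ∀ i j, AnalyticAt ℂ (b i j) 0)
    (hg : AnalyticAt ℂ g 0) (hg0 : g 0 = 0) (hg1 : deriv g 0 = 0)
    (hflat : ∀ i j, ∀ᶠ p in 𝓝 (0 : ℂ × ℂ), p.1 * dirDeriv (0, 1) (b i j) p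
      - p.1 ^ 2 * dirDeriv (1, 0) (a i j) p + p.1 * a i j p + commEntry a b i j p = 0)
    (hN : ∀ᶠ x in 𝓝 (0 : ℂ), ∀ i j, a i 0 (0, x) * a 0 j (0, x) + a i 1 (0, x) * a 1 j (0, x) = 0)
    (hB : ∀ᶠ x in 𝓝 (0 : ℂ), ∀ i j, b i j (0, x)
      = -c * (1 : Matrix (Fin 2) (Fin 2) ℂ) i j - g x * a i j (0, x))
    (h01 : a 0 1 0 ≠ 0) :
    (∀ᶠ x in 𝓝 0, g x = 0) ∨
      (deriv (deriv g) 0 ≠ 0 ∧ deriv (deriv (deriv g)) 0 = 0) := by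
  set Da := entryDeriv (1, 0) a with hDa
  set DDa := entryDeriv (1, 0) Da with hDDa
  set Db := entryDeriv (1, 0) b with hDb
  set DDb := entryDeriv (1, 0) Db with hDDb
  have aDa : ∀ i j, AnalyticAt ℂ (Da i j) 0 := fun i j => (ha i j).dirDeriv _
  have aDDa : ∀ i j, AnalyticAt ℂ (DDa i j) 0 := fun i j => (aDa i j).dirDeriv _
  have aDb : ∀ i j, AnalyticAt ℂ (Db i j) 0 := fun i j => (hb i j).dirDeriv _
  have aDDb : ∀ i j, AnalyticAt ℂ (DDb i j) 0 := fun i j => (aDb i j).dirDeriv _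
  have flat := Filter.eventually_all.2 fun i =>
    Filter.eventually_all.2 fun j => taylor_of_flat ha hb i j (hflat i j)
  have ev : ∀ {f : Fin 2 → Fin 2 → ℂ × ℂ → ℂ}, (∀ i j, AnalyticAt ℂ (f i j) 0) →
      ∀ᶠ x in 𝓝 (0 : ℂ), ∀ i j, AnalyticAt ℂ (f i j) (0, x) := fun hf =>
    Filter.eventually_all.2 fun i => Filter.eventually_all.2 fun j =>
      eventually_slice (hf i j).eventually_analyticAt
  refine second_order_zero_of_flat (n := fun i j x => a i j (0, x))
    (p := fun i j x => Da i j (0, x)) (q := fun i j x => 2⁻¹ * DDa i j (0, x))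
    (b := fun i j x => Db i j (0, x)) (c := fun i j x => 2⁻¹ * DDb i j (0, x))
    (fun i j => (ha i j).slice) (fun i j => (aDa i j).slice)
    (fun i j => analyticAt_const.mul (aDDa i j).slice) (fun i j => (aDb i j).slice)
    (fun i j => analyticAt_const.mul (aDDb i j).slice) hg hg0 hg1 h01 ?_ ?_ ?_ ?_
  · filter_upwards [hN] with x hN
    ext i j
    simpa [evalMat, Matrix.mul_apply, Fin.sum_univ_two] using hN i j
  · filter_upwards [flat, hB, hB.eventually_nhds, ev ha, ev hb, hg.eventually_analyticAt]
      with x flat hB hB' ha hb hg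
    ext i j
    obtain ⟨f1, -, -⟩ := flat i j
    have e1 : dirDeriv (0, 1) (b i j) (0, x) = -(deriv g x * a i j (0, x)
        + g x * deriv (fun x => a i j (0, x)) x) := by
      rw [← (hasDerivAt_slice (hb i j)).deriv]
      have : (fun x => b i j (0, x)) =ᶠ[𝓝 x]
          fun x => -c * (1 : Matrix (Fin 2) (Fin 2) ℂ) i j - g x * a i j (0, x) := by
        filter_upwards [hB'] with y hy using hy i j
      rw [this.deriv_eq]
      exact ((hg.differentiableAt.hasDerivAt.mul
        (ha i j).slice.differentiableAt.hasDerivAt).const_sub _).deriv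
    rw [commEntry_smul_left hB, e1] at f1
    simp only [commEntry, Pi.add_apply, Pi.sub_apply, Pi.mul_apply] at f1
    simp only [evalMat, derivMat, Matrix.add_apply, Matrix.sub_apply, Matrix.smul_apply,
      Matrix.mul_apply, Fin.sum_univ_two, Matrix.of_apply, smul_eq_mul, Matrix.zero_apply]
    linear_combination f1
  · filter_upwards [flat, hB, ev aDb] with x flat hB aDb
    ext i j
    obtain ⟨-, f2, -⟩ := flat i j
    rw [commEntry_smul_left hB, ← (hasDerivAt_slice (aDb i j)).deriv] at f2
    simp only [commEntry, Pi.add_apply, Pi.sub_apply, Pi.mul_apply] at f2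
    simp only [evalMat, derivMat, Matrix.add_apply, Matrix.sub_apply, Matrix.smul_apply,
      Matrix.mul_apply, Fin.sum_univ_two, Matrix.of_apply, smul_eq_mul, Matrix.zero_apply]
    linear_combination f2 / 2
  · filter_upwards [flat, hB, ev aDDb] with x flat hB aDDb
    -- The third order coefficients of `b` and `a` enter only as `B₃ + g A₃`, inside a commutator
    -- with `N`.
    refine ⟨Matrix.of fun i j => 6⁻¹ * entryDeriv (1, 0) DDb i j (0, x)
      + g x * (6⁻¹ * entryDeriv (1, 0) DDa i j (0, x)), ?_⟩
    ext i j
    obtain ⟨-, -, f3⟩ := flat i j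
    have e3 : deriv (fun x => 2⁻¹ * DDb i j (0, x)) x
        = 2⁻¹ * dirDeriv (0, 1) (DDb i j) (0, x) :=
      ((hasDerivAt_slice (aDDb i j)).const_mul 2⁻¹).deriv
    rw [commEntry_smul_left hB] at f3
    simp only [commEntry, Pi.add_apply, Pi.sub_apply, Pi.mul_apply] at f3
    simp only [evalMat, derivMat, Matrix.add_apply, Matrix.sub_apply,
      Matrix.mul_apply, Fin.sum_univ_two, Matrix.of_apply, Matrix.zero_apply, e3]
    linear_combination f3 / 6

theorem commEntry_rev (a b : Fin 2 → Fin 2 → ℂ × ℂ → ℂ) (i j : Fin 2) :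
    commEntry (fun i j => a i.rev j.rev) (fun i j => b i.rev j.rev) i j
      = commEntry a b i.rev j.rev := by
  have h0 : (0 : Fin 2).rev = 1 := rfl
  have h1 : (1 : Fin 2).rev = 0 := rfl
  simp only [commEntry, h0, h1]
  ring

/-- The necessary condition for the coefficient `g` of the Euler field, along `t₁ = 0`. -/
theorem hasListedJet_of_flat {a b : Fin 2 → Fin 2 → ℂ × ℂ → ℂ} {g : ℂ → ℂ} {c : ℂ}
    (ha : ∀ i j, AnalyticAt ℂ (a i j) 0) (hb : ∀ i j, AnalyticAt ℂ (b i j) 0)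
    (hg : AnalyticAt ℂ g 0)
    (hflat : ∀ i j, ∀ᶠ p in 𝓝 (0 : ℂ × ℂ), p.1 * dirDeriv (0, 1) (b i j) p
      - p.1 ^ 2 * dirDeriv (1, 0) (a i j) p + p.1 * a i j p + commEntry a b i j p = 0)
    (hN : ∀ᶠ x in 𝓝 (0 : ℂ), ∀ i j, a i 0 (0, x) * a 0 j (0, x) + a i 1 (0, x) * a 1 j (0, x) = 0)
    (hB : ∀ᶠ x in 𝓝 (0 : ℂ), ∀ i j, b i j (0, x)
      = -c * (1 : Matrix (Fin 2) (Fin 2) ℂ) i j - g x * a i j (0, x))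
    (hne : ∃ i j, a i j 0 ≠ 0) : N2.HasListedJet g := by
  by_cases hg0 : g 0 = 0
  swap; · exact Or.inr (Or.inl hg0)
  by_cases hg1 : deriv g 0 = 0
  swap; · exact Or.inr (Or.inr (Or.inl hg1))
  suffices h : (∀ᶠ x in 𝓝 0, g x = 0) ∨
      (deriv (deriv g) 0 ≠ 0 ∧ deriv (deriv (deriv g)) 0 = 0) by
    rcases h with h | h
    · exact Or.inl h
    · exact Or.inr (Or.inr (Or.inr h))
  by_cases h01 : a 0 1 0 = 0
  -- A nonzero nilpotent `2 × 2` matrix has a nonzero off-diagonal entry. If it is the lower one,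
  -- exchanging the two basis vectors reduces to the other case.
  · have h10 : a 1 0 0 ≠ 0 := by
      intro h10
      have h := hN.self_of_nhds
      change ∀ i j, a i 0 0 * a 0 j 0 + a i 1 0 * a 1 j 0 = 0 at h
      have h00 : a 0 0 0 = 0 := by simpa [h01] using h 0 0
      have h11 : a 1 1 0 = 0 := by simpa [h10] using h 1 1
      obtain ⟨i, j, hij⟩ := hne
      fin_cases i <;> fin_cases j <;> simp_all
    refine second_order_zero_of_flat_of_ne (a := fun i j => a i.rev j.rev)
      (b := fun i j => b i.rev j.rev) (c := c) (fun i j => ha _ _) (fun i j => hb _ _)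
      hg hg0 hg1 (fun i j => ?_) ?_ ?_ h10
    · rw [commEntry_rev]; exact hflat _ _
    · filter_upwards [hN] with x hN i j
      rw [add_comm]; exact hN _ _
    · filter_upwards [hB] with x hB i j
      rw [hB]
      simp [Matrix.one_apply]
  · exact second_order_zero_of_flat_of_ne ha hb hg hg0 hg1 hflat hN hB h01

namespace TEStructure

variable {r : ℕ} {Δ : Set ℂ} {U : Set (Fin 2 → ℂ)}

theorem higgs_single (S : TEStructure 2 r Δ U) (t : Fin 2 → ℂ) (i : Fin 2) :
    S.higgs t (Pi.single i 1) = S.A i (0, t) := by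
  simp [higgs, Pi.single_apply]

/-- The evaluation of the Higgs field at a vector. -/
def higgsVec (S : TEStructure 2 r Δ U) (t : Fin 2 → ℂ) (v : Fin r → ℂ) :
    (Fin 2 → ℂ) →ₗ[ℂ] (Fin r → ℂ) where
  toFun X := (S.higgs t X).mulVec v
  map_add' X Y := by simp [higgs, add_smul, Matrix.add_mulVec]; abel
  map_smul' k X := by simp [higgs, Matrix.add_mulVec, Matrix.smul_mulVec, smul_smul]

/-- A primitive section identifies the fibre with the two-dimensional tangent space. -/
theorem Unfolding.rank_eq_two {S : TEStructure 2 r Δ U} (h : S.Unfolding) {p : Fin 2 → ℂ}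
    (hp : p ∈ U) : r = 2 := by
  obtain ⟨V, -, hpV, -, ζ, -, hζ⟩ := h p hp
  have e := LinearEquiv.ofBijective (S.higgsVec p (ζ p)) (hζ p hpV)
  simpa using e.finrank_eq.symm

theorem Unfolding.A_ne_zero {S : TEStructure 2 r Δ U} (h : S.Unfolding) {p : Fin 2 → ℂ}
    (hp : p ∈ U) (i : Fin 2) : S.A i (0, p) ≠ 0 := by
  obtain ⟨V, -, hpV, -, ζ, -, hζ⟩ := h p hp
  intro h0
  have := (hζ p hpV).injective (a₁ := Pi.single i 1) (a₂ := 0)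
    (by simp [h0, higgs])
  simpa using congrFun this i

theorem LiesOverN2.A_zero_eq_one {S : TEStructure 2 r Δ U} (h : S.LiesOverN2) {t : Fin 2 → ℂ}
    (ht : t ∈ U) : S.A 0 (0, t) = 1 := by
  rw [← h.2.2 t ht]; simp [higgs, N2.unit]

theorem LiesOverN2.A_one_sq {S : TEStructure 2 r Δ U} (h : S.LiesOverN2) {t : Fin 2 → ℂ}
    (ht : t ∈ U) : S.A 1 (0, t) * S.A 1 (0, t) = 0 := by
  rw [← higgs_single, ← h.2.1 t ht]
  simp [higgs, N2.mul]

end TEStructure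

/-- The embedding `(z, x) ↦ (z, 0, x)`. -/
def axisEmbedding : ℂ × ℂ →L[ℂ] ℂ × (Fin 2 → ℂ) :=
  (ContinuousLinearMap.fst ℂ ℂ ℂ).prod
    ((ContinuousLinearMap.single ℂ (fun _ : Fin 2 => ℂ) 1).comp (ContinuousLinearMap.snd ℂ ℂ ℂ))

theorem axisEmbedding_apply (p : ℂ × ℂ) : axisEmbedding p = (p.1, Pi.single 1 p.2) := rfl

theorem dirDeriv_comp_axisEmbedding {F : ℂ × (Fin 2 → ℂ) → ℂ} {p : ℂ × ℂ}
    (hF : AnalyticAt ℂ F (axisEmbedding p)) (v : ℂ × ℂ) :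
    dirDeriv v (fun p => F (axisEmbedding p)) p
      = fderiv ℂ F (axisEmbedding p) (axisEmbedding v) := by
  have := hF.differentiableAt.hasFDerivAt.comp p axisEmbedding.hasFDerivAt
  have h2 : fderiv ℂ (fun p => F (axisEmbedding p)) p = _ := this.fderiv
  rw [dirDeriv, h2]; rfl

/-- An Euler field which is induced by a `(TE)`-structure satisfies the jet condition. -/
theorem N2.IsInducedByTE.hasListedJet {Δ : Set ℂ} (hΔ : IsOpen Δ) (h0 : (0 : ℂ) ∈ Δ)
    {E : (Fin 2 → ℂ) → (Fin 2 → ℂ)} {g : ℂ → ℂ} {c : ℂ} (hg : AnalyticAt ℂ g 0)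
    (hE : ∀ᶠ t in 𝓝 (0 : Fin 2 → ℂ), E t = ![t 0 + c, g (t 1)])
    (h : N2.IsInducedByTE Δ E) : N2.HasListedJet g := by
  obtain ⟨U, hU, h0U, r, S, hS, hSE⟩ := h
  obtain rfl : r = 2 := hS.1.rank_eq_two h0U
  have hcont : Continuous axisEmbedding := axisEmbedding.continuous
  have hmem : ∀ᶠ p in 𝓝 (0 : ℂ × ℂ), axisEmbedding p ∈ Δ ×ˢ U :=
    (hcont.tendsto' 0 0 (map_zero _)).eventually ((hΔ.prod hU).mem_nhds ⟨h0, h0U⟩)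
  have hmem' : ∀ᶠ x in 𝓝 (0 : ℂ), (Pi.single 1 x : Fin 2 → ℂ) ∈ U ∧
      E (Pi.single 1 x) = ![c, g x] := by
    have hs : Filter.Tendsto (fun x : ℂ => (Pi.single 1 x : Fin 2 → ℂ)) (𝓝 0) (𝓝 0) :=
      (ContinuousLinearMap.single ℂ (fun _ : Fin 2 => ℂ) 1).continuous.tendsto' 0 0 (map_zero _)
    filter_upwards [hs.eventually (hU.mem_nhds h0U), hs.eventually hE] with x h1 h2
    exact ⟨h1, by simpa using h2⟩
  have h00 : axisEmbedding 0 ∈ Δ ×ˢ U := hmem.self_of_nhds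
  refine hasListedJet_of_flat (a := fun i j p => S.A 1 (axisEmbedding p) i j)
    (b := fun i j p => S.B (axisEmbedding p) i j) (c := c) ?_ ?_ hg ?_ ?_ ?_ ?_
  · intro i j
    exact AnalyticAt.comp (g := fun p => S.A 1 p i j) (S.holo_A 1 i j _ h00)
      (axisEmbedding.analyticAt 0)
  · intro i j
    exact AnalyticAt.comp (g := fun p => S.B p i j) (S.holo_B i j _ h00)
      (axisEmbedding.analyticAt 0)
  · intro i j
    filter_upwards [hmem] with p hp
    have := congrFun (congrFun (S.flat_zt 1 _ hp) i) j
    rw [dirDeriv_comp_axisEmbedding (F := fun p => S.B p i j) (S.holo_B i j _ hp),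
      dirDeriv_comp_axisEmbedding (F := fun p => S.A 1 p i j) (S.holo_A 1 i j _ hp)]
    simp only [Matrix.add_apply, Matrix.sub_apply, Matrix.smul_apply, Matrix.mul_apply,
      Fin.sum_univ_two, smul_eq_mul, matrixDt, matrixDz, Matrix.of_apply, Matrix.zero_apply]
      at this
    simp only [commEntry, Pi.add_apply, Pi.sub_apply, Pi.mul_apply, axisEmbedding_apply,
      Pi.single_zero] at this ⊢
    exact this
  · filter_upwards [hmem'] with x hx i j
    have := congrFun (congrFun (hS.A_one_sq hx.1) i) j
    simpa [Matrix.mul_apply, Fin.sum_univ_two, axisEmbedding_apply] using this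
  · filter_upwards [hmem'] with x hx i j
    have := congrFun (congrFun (hSE _ hx.1) i) j
    rw [hx.2] at this
    simp only [TEStructure.higgs, TEStructure.poleEnd, Fin.sum_univ_two, hS.A_zero_eq_one hx.1,
      Matrix.add_apply, Matrix.smul_apply, Matrix.neg_apply, smul_eq_mul, Matrix.cons_val_zero,
      Matrix.cons_val_one] at this
    simp only [axisEmbedding_apply]
    linear_combination this
  · by_contra! hcon
    refine hS.1.A_ne_zero h0U 1 ?_
    ext i j
    simpa [axisEmbedding_apply] using hcon i j

/-! ### Euler fields and automorphisms of `𝓝₂` in coordinates -/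

theorem tendsto_single (i : Fin 2) :
    Filter.Tendsto (fun x : ℂ => (Pi.single i x : Fin 2 → ℂ)) (𝓝 0) (𝓝 0) :=
  (ContinuousLinearMap.single ℂ (fun _ : Fin 2 => ℂ) i).continuous.tendsto' 0 0 (map_zero _)

theorem tendsto_apply (i : Fin 2) :
    Filter.Tendsto (fun t : Fin 2 → ℂ => t i) (𝓝 0) (𝓝 0) :=
  (continuous_apply i).tendsto' 0 0 rfl

theorem fderiv_component {F : (Fin 2 → ℂ) → (Fin 2 → ℂ)} {t : Fin 2 → ℂ} (hF : AnalyticAt ℂ F t)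
    (i : Fin 2) (v : Fin 2 → ℂ) : fderiv ℂ (fun s => F s i) t v = fderiv ℂ F t v i := by
  have h : HasFDerivAt (fun s => F s i)
      ((ContinuousLinearMap.proj (R := ℂ) (φ := fun _ : Fin 2 => ℂ) i).comp (fderiv ℂ F t)) t :=
    hasFDerivAt_pi'.1 hF.differentiableAt.hasFDerivAt i
  rw [h.fderiv]; rfl

theorem AnalyticAt.component {F : (Fin 2 → ℂ) → (Fin 2 → ℂ)} {t : Fin 2 → ℂ}
    (hF : AnalyticAt ℂ F t) (i : Fin 2) : AnalyticAt ℂ (fun s => F s i) t :=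
  (ContinuousLinearMap.proj (R := ℂ) (φ := fun _ : Fin 2 => ℂ) i).analyticAt _ |>.comp hF

theorem update_zero_eq_single (t : Fin 2 → ℂ) :
    Function.update t 0 0 = Pi.single 1 (t 1) := by
  ext i; fin_cases i <;> simp

/-- Vector fields and maps of the form which occurs for Euler fields and automorphisms. -/
theorem exists_eq_of_fderiv {F : (Fin 2 → ℂ) → (Fin 2 → ℂ)} (hF : AnalyticAt ℂ F 0)
    (h00 : ∀ᶠ t in 𝓝 (0 : Fin 2 → ℂ), fderiv ℂ F t (Pi.single 0 1) = Pi.single 0 1)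
    (h10 : ∀ᶠ t in 𝓝 (0 : Fin 2 → ℂ), fderiv ℂ F t (Pi.single 1 1) 0 = 0) :
    ∀ᶠ t in 𝓝 (0 : Fin 2 → ℂ), F t = ![t 0 + F 0 0, F (Pi.single 1 (t 1)) 1] := by
  set f : (Fin 2 → ℂ) → ℂ := fun t => F t 0 - t 0 with hf
  have ha : AnalyticAt ℂ f 0 := (hF.component 0).sub
    ((ContinuousLinearMap.proj (R := ℂ) (φ := fun _ : Fin 2 => ℂ) 0).analyticAt _)
  have hfd : ∀ᶠ t in 𝓝 (0 : Fin 2 → ℂ), ∀ v, fderiv ℂ f t v = fderiv ℂ F t v 0 - v 0 := by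
    filter_upwards [hF.eventually_analyticAt] with t ht v
    have h1 := (ht.component 0).differentiableAt.hasFDerivAt.sub
      ((ContinuousLinearMap.proj (R := ℂ) (φ := fun _ : Fin 2 => ℂ) 0).hasFDerivAt (x := t))
    have h2 : fderiv ℂ f t = _ := h1.fderiv
    rw [h2, ← fderiv_component ht]; rfl
  have e0 := eventually_eq_update_of_fderiv_single ha 0 (by
    filter_upwards [hfd, h00] with t h1 h2
    rw [h1, h2]; simp)
  have e1 := eventually_eq_update_of_fderiv_single ha 1 (by
    filter_upwards [hfd, h10] with t h1 h2
    rw [h1, h2]; simp)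
  have e2 := eventually_eq_update_of_fderiv_single (hF.component 1) 0 (by
    filter_upwards [hF.eventually_analyticAt, h00] with t h1 h2
    rw [fderiv_component h1, h2]; simp)
  filter_upwards [e0, ((tendsto_single 1).comp (tendsto_apply 1)).eventually e1, e2]
    with t e0 e1 e2
  simp only [update_zero_eq_single, Function.comp] at e0 e1 e2
  have e3 : (Function.update (Pi.single 1 (t 1)) 1 0 : Fin 2 → ℂ) = 0 := by
    ext i; fin_cases i <;> simp
  rw [e1, e3] at e0
  ext i
  fin_cases i
  · simp only [hf, Pi.zero_apply, sub_zero] at e0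
    simp only [Fin.zero_eta, Matrix.cons_val_zero]
    linear_combination e0
  · simpa using e2

/-- Euler fields on `𝓝₂` are of the form `(t₁ + c) ∂₁ + g(t₂) ∂₂`. -/
theorem N2.IsEulerField.exists_eq {E : (Fin 2 → ℂ) → (Fin 2 → ℂ)} (hE : N2.IsEulerField E) :
    ∃ (c : ℂ) (g : ℂ → ℂ), AnalyticAt ℂ g 0 ∧
      ∀ᶠ t in 𝓝 (0 : Fin 2 → ℂ), E t = ![t 0 + c, g (t 1)] := by
  obtain ⟨ha, h⟩ := hE
  refine ⟨E 0 0, fun x => E (Pi.single 1 x) 1, ?_, exists_eq_of_fderiv ha ?_ ?_⟩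
  · exact AnalyticAt.fun_comp (g := fun t => E t 1)
      (f := ContinuousLinearMap.single ℂ (fun _ : Fin 2 => ℂ) 1)
      (by rw [map_zero]; exact ha.component 1) (ContinuousLinearMap.analyticAt _ 0)
  -- Testing on `X = Y = ∂₁` gives `∂₁E = ∂₁`; testing on `X = Y = ∂₂` below gives `∂₂ ∘ ∂₂E = 0`,
  -- so the first component of `∂₂E` vanishes.
  · filter_upwards [h (fun _ => Pi.single 0 1) (fun _ => Pi.single 0 1) analyticAt_const
      analyticAt_const] with t ht
    have h0 := congrFun ht 0
    have h1 := congrFun ht 1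
    have hm : N2.mul (Pi.single 0 1) (Pi.single 0 1) = Pi.single 0 1 := by
      ext i; fin_cases i <;> simp [N2.mul]
    simp only [hm, VectorField.lieBracket, fderiv_fun_const, Pi.zero_apply, zero_apply,
      zero_sub, Pi.sub_apply] at h0 h1
    simp [N2.mul] at h0 h1
    ext i; fin_cases i
    · simpa using h0
    · simpa using h1
  · filter_upwards [h (fun _ => Pi.single 1 1) (fun _ => Pi.single 1 1) analyticAt_const
      analyticAt_const] with t ht
    have h1 := congrFun ht 1
    have hm : N2.mul (Pi.single 1 1) (Pi.single 1 1) = 0 := by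
      ext i; fin_cases i <;> simp [N2.mul]
    simp only [hm, VectorField.lieBracket, fderiv_fun_const, Pi.zero_apply, zero_apply,
      zero_sub, Pi.sub_apply, map_zero] at h1
    simp [N2.mul] at h1
    exact h1

/-- Automorphisms of `𝓝₂` are of the form `(t₁, t₂) ↦ (t₁, φ(t₂))`. -/
theorem N2.IsAutomorphism.exists_eq {h : (Fin 2 → ℂ) → (Fin 2 → ℂ)} (hh : N2.IsAutomorphism h) :
    ∃ φ : ℂ → ℂ, AnalyticAt ℂ φ 0 ∧ φ 0 = 0 ∧ deriv φ 0 ≠ 0 ∧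
      ∀ᶠ t in 𝓝 (0 : Fin 2 → ℂ), h t = ![t 0, φ (t 1)] := by
  obtain ⟨ha, h0, hbij, hmul⟩ := hh
  have hm00 : N2.mul (Pi.single 0 1) (Pi.single 0 1) = Pi.single 0 1 := by
    ext i; fin_cases i <;> simp [N2.mul]
  have hm11 : N2.mul (Pi.single 1 1) (Pi.single 1 1) = 0 := by
    ext i; fin_cases i <;> simp [N2.mul]
  have hne : fderiv ℂ h 0 (Pi.single 0 1) 0 ≠ 0 := by
    obtain ⟨u, hu⟩ := hbij.surjective (Pi.single 0 1)
    have := congrFun (hmul.self_of_nhds (Pi.single 0 1) u) 0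
    have hm : N2.mul (Pi.single 0 1) u = u := by
      ext i; fin_cases i <;> simp [N2.mul]
    rw [hm, hu] at this
    intro h0
    simp [N2.mul, h0] at this
  have hcont : ContinuousAt (fun t => fderiv ℂ h t (Pi.single 0 1) 0) 0 :=
    continuousAt_pi.1 (ha.fderiv.continuousAt.clm_apply continuousAt_const) 0
  -- The image of `∂₁` is an idempotent with nonzero first component, and the only such idempotent
  -- is `∂₁`.
  have h00 : ∀ᶠ t in 𝓝 (0 : Fin 2 → ℂ), fderiv ℂ h t (Pi.single 0 1) = Pi.single 0 1 := by
    filter_upwards [hmul, hcont.eventually_ne hne] with t ht hne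
    have := ht (Pi.single 0 1) (Pi.single 0 1)
    rw [hm00] at this
    have e0 := congrFun this 0
    have e1 := congrFun this 1
    simp only [N2.mul, Matrix.cons_val_zero, Matrix.cons_val_one] at e0 e1
    have f0 : fderiv ℂ h t (Pi.single 0 1) 0 = 1 :=
      mul_left_cancel₀ hne (by linear_combination -e0)
    rw [f0] at e1
    ext i; fin_cases i
    · simpa using f0
    · simp only [Fin.mk_one]
      rw [Pi.single_eq_of_ne (by decide)]
      linear_combination -e1
  have h10 : ∀ᶠ t in 𝓝 (0 : Fin 2 → ℂ), fderiv ℂ h t (Pi.single 1 1) 0 = 0 := by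
    filter_upwards [hmul] with t ht
    have e0 := congrFun (ht (Pi.single 1 1) (Pi.single 1 1)) 0
    rw [hm11, map_zero] at e0
    simpa [N2.mul] using e0.symm
  have hin : AnalyticAt ℂ (ContinuousLinearMap.single ℂ (fun _ : Fin 2 => ℂ) 1) 0 :=
    ContinuousLinearMap.analyticAt _ 0
  refine ⟨fun x => h (Pi.single 1 x) 1, ?_, by simp [h0], ?_, ?_⟩
  · exact AnalyticAt.fun_comp (g := fun t => h t 1)
      (f := ContinuousLinearMap.single ℂ (fun _ : Fin 2 => ℂ) 1)
      (by rw [map_zero]; exact ha.component 1) hin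
  · have h1 : HasDerivAt (fun x : ℂ => (Pi.single 1 x : Fin 2 → ℂ)) (Pi.single 1 1) 0 := by
      have := (ContinuousLinearMap.single ℂ (fun _ : Fin 2 => ℂ) 1).hasFDerivAt (x := 0)
      exact this.hasDerivAt
    have h2 : HasFDerivAt (fun t => h t 1) (fderiv ℂ (fun t => h t 1) 0)
        (Pi.single 1 (0 : ℂ) : Fin 2 → ℂ) := by
      rw [Pi.single_zero]; exact (ha.component 1).differentiableAt.hasFDerivAt
    rw [show deriv (fun x : ℂ => h (Pi.single 1 x) 1) 0 = _ from
      (h2.comp_hasDerivAt (0 : ℂ) h1).deriv, fderiv_component ha]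
    intro h3
    have : fderiv ℂ h 0 (Pi.single 1 1) = 0 := by
      ext i; fin_cases i
      · exact h10.self_of_nhds
      · exact h3
    have := hbij.injective (this.trans (map_zero _).symm)
    simpa using congrFun this 1
  · simpa [h0] using exists_eq_of_fderiv ha h00 h10

theorem hasFDerivAt_prodMap {φ : ℂ → ℂ} {t : Fin 2 → ℂ} (hφ : AnalyticAt ℂ φ (t 1)) :
    HasFDerivAt (fun t : Fin 2 → ℂ => (![t 0, φ (t 1)] : Fin 2 → ℂ))
      (ContinuousLinearMap.pi
        ![ContinuousLinearMap.proj (R := ℂ) (φ := fun _ : Fin 2 => ℂ) 0,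
          deriv φ (t 1) • ContinuousLinearMap.proj (R := ℂ) (φ := fun _ : Fin 2 => ℂ) 1]) t := by
  refine hasFDerivAt_pi'.2 fun i => ?_
  fin_cases i
  · exact (ContinuousLinearMap.proj (R := ℂ) (φ := fun _ : Fin 2 => ℂ) 0).hasFDerivAt
  · exact hφ.differentiableAt.hasDerivAt.comp_hasFDerivAt t
      (ContinuousLinearMap.proj (R := ℂ) (φ := fun _ : Fin 2 => ℂ) 1).hasFDerivAt

theorem fderiv_prodMap {φ : ℂ → ℂ} {t : Fin 2 → ℂ} (hφ : AnalyticAt ℂ φ (t 1))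
    (v : Fin 2 → ℂ) :
    fderiv ℂ (fun t : Fin 2 → ℂ => (![t 0, φ (t 1)] : Fin 2 → ℂ)) t v
      = ![v 0, deriv φ (t 1) * v 1] := by
  rw [(hasFDerivAt_prodMap hφ).fderiv]
  ext i; fin_cases i <;> simp

theorem N2.isAutomorphism_prodMap {φ : ℂ → ℂ} (hφ : AnalyticAt ℂ φ 0) (h0 : φ 0 = 0)
    (h1 : deriv φ 0 ≠ 0) :
    N2.IsAutomorphism (fun t : Fin 2 → ℂ => (![t 0, φ (t 1)] : Fin 2 → ℂ)) := by
  have hproj : ∀ i, AnalyticAt ℂ (fun t : Fin 2 → ℂ => t i) 0 := fun i =>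
    (ContinuousLinearMap.proj (R := ℂ) (φ := fun _ : Fin 2 => ℂ) i).analyticAt _
  refine ⟨?_, ?_, ⟨?_, ?_⟩, ?_⟩
  · refine AnalyticAt.pi fun i => ?_
    fin_cases i
    · exact hproj 0
    · exact AnalyticAt.fun_comp (g := φ) (f := fun t : Fin 2 → ℂ => t 1) hφ (hproj 1)
  · ext i; fin_cases i <;> simp [h0]
  · intro u v huv
    rw [fderiv_prodMap hφ, fderiv_prodMap hφ] at huv
    have e0 := congrFun huv 0
    have e1 := congrFun huv 1
    ext i; fin_cases i
    · simpa using e0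
    · simpa [h1] using e1
  · intro v
    refine ⟨![v 0, v 1 / deriv φ 0], ?_⟩
    rw [fderiv_prodMap hφ]
    ext i; fin_cases i
    · simp
    · simp [mul_div_cancel₀ _ h1]
  · filter_upwards [(tendsto_apply 1).eventually hφ.eventually_analyticAt] with t ht u v
    simp only [fderiv_prodMap ht]
    ext i; fin_cases i <;> simp [N2.mul]
    ring

namespace N2.EulerNormalForm

/-- The constant `c` of a normal form. -/
def shift : EulerNormalForm → ℂ
  | translation c => c
  | trivial c => c
  | linear c _ _ => c
  | higher c _ _ _ => c

/-- The coefficient of `∂₂` of a normal form. -/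
def coeff : EulerNormalForm → ℂ → ℂ
  | translation _ => fun _ => 1
  | trivial _ => fun _ => 0
  | linear _ c₀ _ => fun x => c₀ * x
  | higher _ c₁ r _ => fun x => x ^ r * (1 + c₁ * x ^ (r - 1))

theorem field_eq (N : EulerNormalForm) (t : Fin 2 → ℂ) :
    N.field t = ![t 0 + N.shift, N.coeff (t 1)] := by
  cases N <;> rfl

end N2.EulerNormalForm

/-- The normal forms of an Euler field in terms of its coefficient. -/
theorem N2.hasNormalForm_iff {E : (Fin 2 → ℂ) → (Fin 2 → ℂ)} {g : ℂ → ℂ} {c : ℂ}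
    (hE : ∀ᶠ t in 𝓝 (0 : Fin 2 → ℂ), E t = ![t 0 + c, g (t 1)]) (N : N2.EulerNormalForm) :
    N2.HasNormalForm E N ↔ N.shift = c ∧ ∃ φ : ℂ → ℂ, AnalyticAt ℂ φ 0 ∧ φ 0 = 0 ∧
      deriv φ 0 ≠ 0 ∧ ∀ᶠ x in 𝓝 0, deriv φ x * g x = N.coeff (φ x) := by
  constructor
  · rintro ⟨h, hh, hEN⟩
    obtain ⟨φ, hφ, hφ0, hφ1, hhφ⟩ := hh.exists_eq
    have key : ∀ᶠ t in 𝓝 (0 : Fin 2 → ℂ),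
        t 0 + c = t 0 + N.shift ∧ deriv φ (t 1) * g (t 1) = N.coeff (φ (t 1)) := by
      filter_upwards [hEN, hE, hhφ.eventually_nhds,
        (tendsto_apply 1).eventually hφ.eventually_analyticAt] with t h1 h2 h3 h4
      have h3' : h =ᶠ[𝓝 t] fun t => ![t 0, φ (t 1)] := h3
      rw [h3'.fderiv_eq, fderiv_prodMap h4, h2, h3'.eq_of_nhds, N.field_eq] at h1
      exact ⟨by simpa using congrFun h1 0, by simpa using congrFun h1 1⟩
    refine ⟨?_, φ, hφ, hφ0, hφ1, ?_⟩
    · have := key.self_of_nhds.1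
      simpa using this.symm
    · filter_upwards [(tendsto_single 1).eventually key] with x hx
      simpa using hx.2
  · rintro ⟨hc, φ, hφ, hφ0, hφ1, hφg⟩
    refine ⟨_, N2.isAutomorphism_prodMap hφ hφ0 hφ1, ?_⟩
    filter_upwards [hE, (tendsto_apply 1).eventually hφg,
      (tendsto_apply 1).eventually hφ.eventually_analyticAt] with t h1 h2 h3
    rw [fderiv_prodMap h3, h1, N.field_eq, hc]
    simpa using h2

/-! ### Construction of `(TE)`-structures -/

section Quadratic

variable {Δ : Set ℂ} {U : Set (Fin 2 → ℂ)} {φ : ℂ → ℂ} {p : ℂ × (Fin 2 → ℂ)}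

theorem hasFDerivAt_comp_coord {ψ : ℂ → ℂ} (i : Fin 2) (h : AnalyticAt ℂ ψ (p.2 i)) :
    HasFDerivAt (fun p : ℂ × (Fin 2 → ℂ) => ψ (p.2 i))
      (deriv ψ (p.2 i) • (ContinuousLinearMap.proj (R := ℂ) (φ := fun _ : Fin 2 => ℂ) i).comp
        (ContinuousLinearMap.snd ℂ ℂ (Fin 2 → ℂ))) p :=
  h.differentiableAt.hasDerivAt.comp_hasFDerivAt p
    ((ContinuousLinearMap.proj (R := ℂ) (φ := fun _ : Fin 2 => ℂ) i).comp
        (ContinuousLinearMap.snd ℂ ℂ (Fin 2 → ℂ))).hasFDerivAt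

theorem analyticAt_comp_coord {ψ : ℂ → ℂ} (i : Fin 2) (h : AnalyticAt ℂ ψ (p.2 i)) :
    AnalyticAt ℂ (fun p : ℂ × (Fin 2 → ℂ) => ψ (p.2 i)) p :=
  AnalyticAt.fun_comp (g := ψ) (f := fun p : ℂ × (Fin 2 → ℂ) => p.2 i) h
    (((ContinuousLinearMap.proj (R := ℂ) (φ := fun _ : Fin 2 => ℂ) i).comp
        (ContinuousLinearMap.snd ℂ ℂ (Fin 2 → ℂ))).analyticAt p)

/-- The coefficients `A₁`, `A₂` of the connection form. -/
def quadraticA (φ : ℂ → ℂ) : Fin 2 → ℂ × (Fin 2 → ℂ) → Matrix (Fin 2) (Fin 2) ℂ :=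
  ![fun _ => 1, fun p => !![0, deriv φ (p.2 1); 0, 0]]

/-- The coefficient `B` of the connection form: the pullback by `φ` of the structure over the
Euler field `(t₁ + c) ∂₁ + (e₀ + e₁ t₂ + e₂ t₂²) ∂₂`. -/
def quadraticB (c e₀ e₁ e₂ : ℂ) (φ : ℂ → ℂ) (p : ℂ × (Fin 2 → ℂ)) : Matrix (Fin 2) (Fin 2) ℂ :=
  -- For `φ = id` take `N = E₁₂`, constant in `x`, and `P = Q = 0`. The `z` equation `[N, B₁] = (g'
  -- - 1) N` is solved by `B₁ = diag(λ, -λ)` with `2λ = 1 - g'`. Then `B₁' + [N, B₂] = 0` is solved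
  -- by `B₂ = e₂ E₂₁`. This is constant, so the expansion stops.
  !![-(p.2 0 + c) + p.1 * ((1 - e₁) / 2 - e₂ * φ (p.2 1)),
      -(e₀ + e₁ * φ (p.2 1) + e₂ * φ (p.2 1) ^ 2);
     e₂ * p.1 ^ 2, -(p.2 0 + c) - p.1 * ((1 - e₁) / 2 - e₂ * φ (p.2 1))]

theorem matrixDt_quadraticB (c e₀ e₁ e₂ : ℂ) (hφ : AnalyticAt ℂ φ (p.2 1)) (i : Fin 2) :
    matrixDt i (quadraticB c e₀ e₁ e₂ φ) p
      = (Pi.single i 1 : Fin 2 → ℂ) 0 • (-1 : Matrix (Fin 2) (Fin 2) ℂ)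
        + (Pi.single i 1 : Fin 2 → ℂ) 1 •
          !![-p.1 * (e₂ * deriv φ (p.2 1)), -((e₁ + 2 * e₂ * φ (p.2 1)) * deriv φ (p.2 1));
            0, p.1 * (e₂ * deriv φ (p.2 1))] := by
  have hz := (ContinuousLinearMap.fst ℂ ℂ (Fin 2 → ℂ)).hasFDerivAt (x := p)
  have hy := hasFDerivAt_comp_coord 1 hφ
  have hm := hz.mul ((hy.const_mul e₂).const_sub ((1 - e₁) / 2))
  have h0 := ((hasFDerivAt_comp_coord (p := p) (ψ := id) 0 analyticAt_id).add_const c).neg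
  have h00 := (h0.add hm).fderiv
  have h11 := (h0.sub hm).fderiv
  have h01 := (((hy.const_mul e₁).const_add e₀).add ((hy.pow 2).const_mul e₂)).neg.fderiv
  have h10 := ((hz.pow 2).const_mul e₂).fderiv
  ext a b
  fin_cases a <;> fin_cases b
  · refine (DFunLike.congr_fun h00 _).trans ?_
    simp; ring
  · refine (DFunLike.congr_fun h01 _).trans ?_
    simp; ring
  · refine (DFunLike.congr_fun h10 _).trans ?_
    simp
  · refine (DFunLike.congr_fun h11 _).trans ?_
    simp; ring

theorem fderiv_quadraticA_zero (v : ℂ × (Fin 2 → ℂ)) :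
    (Matrix.of fun a b => fderiv ℂ (fun q => quadraticA φ 0 q a b) p v) = 0 := by
  ext a b; simp [quadraticA]

theorem fderiv_quadraticA_one (hφ : AnalyticAt ℂ φ (p.2 1)) {v : ℂ × (Fin 2 → ℂ)}
    (hv : v.2 1 = 0) :
    (Matrix.of fun a b => fderiv ℂ (fun q => quadraticA φ 1 q a b) p v) = 0 := by
  have hy := (hasFDerivAt_comp_coord 1 hφ.deriv).fderiv
  ext a b
  fin_cases a <;> fin_cases b
  · simp [quadraticA]
  · refine (DFunLike.congr_fun hy v).trans ?_
    simp [hv]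
  · simp [quadraticA]
  · simp [quadraticA]

theorem analyticAt_quadraticA (hφ : AnalyticAt ℂ φ (p.2 1)) (i a b : Fin 2) :
    AnalyticAt ℂ (fun p => quadraticA φ i p a b) p := by
  have hy := analyticAt_comp_coord 1 hφ.deriv
  fin_cases i
  · exact analyticAt_const
  · fin_cases a <;> fin_cases b
    · exact analyticAt_const
    · exact hy
    · exact analyticAt_const
    · exact analyticAt_const

theorem analyticAt_quadraticB (c e₀ e₁ e₂ : ℂ) (hφ : AnalyticAt ℂ φ (p.2 1)) (a b : Fin 2) :
    AnalyticAt ℂ (fun p => quadraticB c e₀ e₁ e₂ φ p a b) p := by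
  have hz : AnalyticAt ℂ (fun p : ℂ × (Fin 2 → ℂ) => p.1) p := analyticAt_fst
  have h0 : AnalyticAt ℂ (fun p : ℂ × (Fin 2 → ℂ) => p.2 0) p :=
    analyticAt_comp_coord (ψ := id) 0 analyticAt_id
  have hy := analyticAt_comp_coord 1 hφ
  have hm := hz.fun_mul ((analyticAt_const (v := (1 - e₁) / 2)).fun_sub
    ((analyticAt_const (v := e₂)).fun_mul hy))
  have hn := (h0.fun_add (analyticAt_const (v := c))).fun_neg
  fin_cases a <;> fin_cases b
  · exact hn.fun_add hm
  · exact (((analyticAt_const (v := e₀)).fun_add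
      ((analyticAt_const (v := e₁)).fun_mul hy)).fun_add
        ((analyticAt_const (v := e₂)).fun_mul (hy.fun_pow 2))).fun_neg
  · exact (analyticAt_const (v := e₂)).fun_mul (hz.fun_pow 2)
  · exact hn.fun_sub hm

/-- The `(TE)`-structure with the coefficients `quadraticA`, `quadraticB`. -/
def quadraticTE (Δ : Set ℂ) (c e₀ e₁ e₂ : ℂ) (hφ : ∀ t ∈ U, AnalyticAt ℂ φ (t 1)) :
    TEStructure 2 2 Δ U where
  A := quadraticA φ
  B := quadraticB c e₀ e₁ e₂ φ
  holo_A i a b p hp := analyticAt_quadraticA (hφ _ hp.2) i a b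
  holo_B a b p hp := analyticAt_quadraticB c e₀ e₁ e₂ (hφ _ hp.2) a b
  flat_tt i j p hp := by
    have h10 : matrixDt 1 (quadraticA φ 0) p = 0 := fderiv_quadraticA_zero _
    have h01 : matrixDt 0 (quadraticA φ 1) p = 0 :=
      fderiv_quadraticA_one (hφ _ hp.2) (by simp)
    have hA0 : quadraticA φ 0 p = 1 := rfl
    fin_cases i <;> fin_cases j
    · simp
    · simp only [Fin.zero_eta, Fin.mk_one, h10, h01, hA0]; simp
    · simp only [Fin.zero_eta, Fin.mk_one, h10, h01, hA0]; simp
    · simp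
  flat_zt i p hp := by
    have h0 : matrixDz (quadraticA φ 0) p = 0 := fderiv_quadraticA_zero _
    have h1 : matrixDz (quadraticA φ 1) p = 0 :=
      fderiv_quadraticA_one (hφ _ hp.2) (by simp)
    have hA0 : quadraticA φ 0 p = 1 := rfl
    have hA1 : quadraticA φ 1 p = !![0, deriv φ (p.2 1); 0, 0] := rfl
    rw [matrixDt_quadraticB _ _ _ _ (hφ _ hp.2)]
    fin_cases i
    · simp [h0, hA0]
    · simp only [Fin.mk_one, h1, hA1]
      ext a b
      fin_cases a <;> fin_cases b <;> simp [quadraticB] <;> ring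

theorem quadraticTE_higgs (Δ : Set ℂ) (c e₀ e₁ e₂ : ℂ) (hφ : ∀ t ∈ U, AnalyticAt ℂ φ (t 1))
    (t X : Fin 2 → ℂ) :
    (quadraticTE Δ c e₀ e₁ e₂ hφ).higgs t X = !![X 0, X 1 * deriv φ (t 1); 0, X 0] := by
  ext a b
  fin_cases a <;> fin_cases b <;> simp [TEStructure.higgs, quadraticTE, quadraticA]

theorem quadraticTE_liesOverN2 (Δ : Set ℂ) (c e₀ e₁ e₂ : ℂ) (hU : IsOpen U)
    (hφ : ∀ t ∈ U, AnalyticAt ℂ φ (t 1)) (hφ1 : ∀ t ∈ U, deriv φ (t 1) ≠ 0) :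
    (quadraticTE Δ c e₀ e₁ e₂ hφ).LiesOverN2 := by
  refine ⟨?_, ?_, ?_⟩
  · intro p hp
    -- The second basis vector is primitive because it lies outside the kernel of `A₂`.
    refine ⟨U, hU, hp, subset_rfl, fun _ => ![0, 1], fun _ _ => analyticAt_const, ?_⟩
    intro t ht
    have hne := hφ1 t ht
    have hv : ∀ X, ((quadraticTE Δ c e₀ e₁ e₂ hφ).higgs t X).mulVec ![0, 1]
        = ![X 1 * deriv φ (t 1), X 0] := by
      intro X
      rw [quadraticTE_higgs]
      ext i; fin_cases i <;> simp [Matrix.mulVec, dotProduct, Fin.sum_univ_two]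
    simp only [hv]
    constructor
    · intro X Y hXY
      have h0 := congrFun hXY 0
      have h1 := congrFun hXY 1
      ext i; fin_cases i
      · simpa using h1
      · simpa [hne] using h0
    · intro Y
      refine ⟨![Y 1, Y 0 / deriv φ (t 1)], ?_⟩
      ext i; fin_cases i <;> simp [hne]
  · intro t _ X Y
    simp only [quadraticTE_higgs]
    ext a b
    fin_cases a <;> fin_cases b <;> simp [N2.mul]
    ring
  · intro t _
    rw [quadraticTE_higgs]
    ext a b
    fin_cases a <;> fin_cases b <;> simp [N2.unit]

end Quadratic

/-- An Euler field whose coefficient is the pullback of a quadratic polynomial vector field is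
induced by a `(TE)`-structure. -/
theorem N2.isInducedByTE_of_quadratic (Δ : Set ℂ) {E : (Fin 2 → ℂ) → (Fin 2 → ℂ)} {g φ : ℂ → ℂ}
    {c e₀ e₁ e₂ : ℂ} (hE : ∀ᶠ t in 𝓝 (0 : Fin 2 → ℂ), E t = ![t 0 + c, g (t 1)])
    (hφ : AnalyticAt ℂ φ 0) (hφ1 : deriv φ 0 ≠ 0)
    (hg : ∀ᶠ x in 𝓝 0, deriv φ x * g x = e₀ + e₁ * φ x + e₂ * φ x ^ 2) :
    N2.IsInducedByTE Δ E := by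
  obtain ⟨U, hU, hUo, h0U⟩ := eventually_nhds_iff.1
    (hE.and ((tendsto_apply 1).eventually (hφ.eventually_analyticAt.and
      (hg.and (hφ.deriv.continuousAt.eventually_ne hφ1)))))
  refine ⟨U, hUo, h0U, 2, quadraticTE Δ c e₀ e₁ e₂ fun t ht => (hU t ht).2.1,
    quadraticTE_liesOverN2 Δ c e₀ e₁ e₂ hUo _ fun t ht => (hU t ht).2.2.2, ?_⟩
  intro t ht
  obtain ⟨hEt, -, hgt, -⟩ := hU t ht
  rw [quadraticTE_higgs, hEt]
  ext a b
  fin_cases a <;> fin_cases b <;> simp [TEStructure.poleEnd, quadraticTE, quadraticB]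
  linear_combination hgt

/-- Euler fields with a listed normal form are induced by `(TE)`-structures. -/
theorem N2.isInducedByTE_of_isListed (Δ : Set ℂ) {E : (Fin 2 → ℂ) → (Fin 2 → ℂ)} {g : ℂ → ℂ}
    {c : ℂ} (hE : ∀ᶠ t in 𝓝 (0 : Fin 2 → ℂ), E t = ![t 0 + c, g (t 1)])
    {N : N2.EulerNormalForm} (hN : N2.HasNormalForm E N) (hl : N.IsListed) :
    N2.IsInducedByTE Δ E := by
  obtain ⟨-, φ, hφ, -, hφ1, hg⟩ := (N2.hasNormalForm_iff hE N).1 hN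
  cases N with
  | translation c =>
    refine N2.isInducedByTE_of_quadratic Δ (e₀ := 1) (e₁ := 0) (e₂ := 0) hE hφ hφ1 ?_
    simpa [N2.EulerNormalForm.coeff] using hg
  | trivial c =>
    refine N2.isInducedByTE_of_quadratic Δ (e₀ := 0) (e₁ := 0) (e₂ := 0) hE hφ hφ1 ?_
    simpa [N2.EulerNormalForm.coeff] using hg
  | linear c c₀ hc₀ =>
    refine N2.isInducedByTE_of_quadratic Δ (e₀ := 0) (e₁ := c₀) (e₂ := 0) hE hφ hφ1 ?_
    simpa [N2.EulerNormalForm.coeff] using hg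
  | higher c c₁ r hr =>
    obtain ⟨rfl, rfl⟩ := hl
    refine N2.isInducedByTE_of_quadratic Δ (e₀ := 0) (e₁ := 0) (e₂ := 1) hE hφ hφ1 ?_
    simpa [N2.EulerNormalForm.coeff] using hg

/-! ### Normal forms of Euler fields with the jet condition -/

/-- The jet condition implies the existence of a listed normal form. -/
theorem N2.HasListedJet.exists_normalForm {E : (Fin 2 → ℂ) → (Fin 2 → ℂ)} {g : ℂ → ℂ} {c : ℂ}
    (hg : AnalyticAt ℂ g 0) (hE : ∀ᶠ t in 𝓝 (0 : Fin 2 → ℂ), E t = ![t 0 + c, g (t 1)])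
    (h : N2.HasListedJet g) : ∃ N : N2.EulerNormalForm, N2.HasNormalForm E N ∧ N.IsListed := by
  by_cases hg0 : g 0 = 0
  swap
  · refine ⟨.translation c, (N2.hasNormalForm_iff hE _).2 ⟨rfl, ?_⟩, True.intro⟩
    -- The flow box coordinate: `φ' = 1/g`.
    obtain ⟨φ, hφ, hφ0, hφ1⟩ := (hg.inv hg0).exists_primitive 0
    refine ⟨φ, hφ, hφ0, ?_, ?_⟩
    · rw [hφ1.self_of_nhds.deriv]; exact inv_ne_zero hg0
    · filter_upwards [hφ1, hg.continuousAt.eventually_ne hg0] with x h1 h2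
      rw [h1.deriv]
      exact inv_mul_cancel₀ h2
  by_cases hg1 : deriv g 0 = 0
  swap
  · refine ⟨.linear c (deriv g 0) hg1, (N2.hasNormalForm_iff hE _).2 ⟨rfl, ?_⟩, True.intro⟩
    obtain ⟨u, hu, hu0, hgu⟩ := hg.exists_eq_mul_of_zero hg0
    have hu0' : u 0 ≠ 0 := by rwa [hu0]
    -- The equation to solve is `φ'/φ = u(0)/g = 1/x + e` with `x e = u(0)/u - 1`, hence `φ = x
    -- exp(∫ e)`.
    have hw : AnalyticAt ℂ (fun x => u 0 / u x - 1) 0 :=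
      (analyticAt_const.div hu hu0').sub analyticAt_const
    obtain ⟨e, he, -, hwe⟩ := hw.exists_eq_mul_of_zero (by simp [hu0'])
    obtain ⟨F, hF, hF0, hFe⟩ := he.exists_primitive 0
    have hd : ∀ᶠ x in 𝓝 0, HasDerivAt (fun x => x * Complex.exp (F x))
        (Complex.exp (F x) * (1 + x * e x)) x := by
      filter_upwards [hFe] with x hx
      refine ((hasDerivAt_id x).mul hx.cexp).congr_deriv ?_
      simp; ring
    refine ⟨fun x => x * Complex.exp (F x), analyticAt_id.mul hF.cexp, by simp, ?_, ?_⟩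
    · rw [hd.self_of_nhds.deriv]; simp
    · filter_upwards [hd, hwe, hgu, hu.continuousAt.eventually_ne hu0'] with x h1 h2 h3 h4
      have h5 : (1 + x * e x) * u x = u 0 := by
        rw [← h2]; field_simp; ring
      rw [h1.deriv, h3, N2.EulerNormalForm.coeff, ← hu0, ← h5]
      ring
  rcases h with h | h | h | ⟨h2, h3⟩
  · refine ⟨.trivial c, (N2.hasNormalForm_iff hE _).2
      ⟨rfl, id, analyticAt_id, rfl, by simp, ?_⟩, True.intro⟩
    filter_upwards [h] with x hx
    rw [hx, mul_zero]; rfl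
  · exact absurd hg0 h
  · exact absurd hg1 h
  · refine ⟨.higher c 0 2 le_rfl, (N2.hasNormalForm_iff hE _).2 ⟨rfl, ?_⟩, rfl, rfl⟩
    obtain ⟨u, hu, hgu⟩ := hg.exists_eq_sq_mul hg0 hg1
    obtain ⟨-, -, hu2, hu3⟩ := derivs_of_eq_sq_mul hu hgu
    have hu0 : u 0 ≠ 0 := by
      intro h0; rw [h0, mul_zero] at hu2; exact h2 hu2
    have hu1 : deriv u 0 = 0 := by
      rw [h3] at hu3; simpa using hu3.symm
    have hw : AnalyticAt ℂ (fun x => (u x)⁻¹ - (u 0)⁻¹) 0 := (hu.inv hu0).sub analyticAt_const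
    obtain ⟨e, he, hwe⟩ := hw.exists_eq_sq_mul (by simp) (by
      rw [((hu.differentiableAt.hasDerivAt.fun_inv hu0).sub_const _).deriv, hu1]; simp)
    obtain ⟨F, hF, hF0, hFe⟩ := he.exists_primitive 0
    -- The equation `φ'/φ² = 1/g` says that `-1/φ` is a primitive of `1/g = u(0)⁻¹ x⁻² + e`. There
    -- is no `1/x` term because `u'(0) = 0`, so no logarithm arises and `1/φ = D/x`.
    set D : ℂ → ℂ := fun x => (u 0)⁻¹ - x * F x with hD
    have hDa : AnalyticAt ℂ D 0 := analyticAt_const.sub (analyticAt_id.mul hF)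
    have hD0 : D 0 ≠ 0 := by simpa [hD] using hu0
    have hd : ∀ᶠ x in 𝓝 0, HasDerivAt (fun x => x / D x)
        (((u 0)⁻¹ + x ^ 2 * e x) / D x ^ 2) x := by
      filter_upwards [hFe, hDa.continuousAt.eventually_ne hD0] with x hx hDx
      have hD' : HasDerivAt D (-(1 * F x + x * e x)) x :=
        ((hasDerivAt_id x).mul hx).const_sub _
      refine ((hasDerivAt_id x).div hD' hDx).congr_deriv ?_
      congr 1
      simp only [hD, id]; ring
    refine ⟨fun x => x / D x, analyticAt_id.div hDa hD0, by simp, ?_, ?_⟩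
    · rw [hd.self_of_nhds.deriv]
      simp [hu0, hD0]
    · filter_upwards [hd, hwe, hgu, hu.continuousAt.eventually_ne hu0,
        hDa.continuousAt.eventually_ne hD0] with x h1 h2 h3 h4 h5
      have h6 : ((u 0)⁻¹ + x ^ 2 * e x) * u x = 1 := by
        rw [← h2, add_sub_cancel]; exact inv_mul_cancel₀ h4
      rw [h1.deriv, h3]
      change _ = (x / D x) ^ 2 * (1 + 0 * (x / D x) ^ (2 - 1))
      rw [div_pow, zero_mul, add_zero, mul_one, div_mul_eq_mul_div]
      congr 1
      linear_combination x ^ 2 * h6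

/-- Any normal form of an Euler field with the jet condition is listed. -/
theorem N2.HasListedJet.isListed {E : (Fin 2 → ℂ) → (Fin 2 → ℂ)} {g : ℂ → ℂ} {c : ℂ}
    (hE : ∀ᶠ t in 𝓝 (0 : Fin 2 → ℂ), E t = ![t 0 + c, g (t 1)])
    (h : N2.HasListedJet g) {N : N2.EulerNormalForm} (hN : N2.HasNormalForm E N) :
    N.IsListed := by
  obtain ⟨-, φ, hφ, hφ0, hφ1, hg⟩ := (N2.hasNormalForm_iff hE N).1 hN
  cases N with
  | translation c => exact True.intro
  | trivial c => exact True.intro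
  | linear c c₀ hc₀ => exact True.intro
  | higher c c₁ r hr =>
    obtain ⟨k, rfl⟩ := Nat.exists_eq_add_of_le hr
    obtain ⟨μ, hμ, hμ0, hφμ⟩ := hφ.exists_eq_mul_of_zero hφ0
    have hμne : μ 0 ≠ 0 := by rwa [hμ0]
    set D : ℂ → ℂ := fun x => μ x + x * deriv μ x with hD
    have hDa : AnalyticAt ℂ D 0 := hμ.add (analyticAt_id.mul hμ.deriv)
    have hD0 : D 0 = μ 0 := by simp [hD]
    have hφD : ∀ᶠ x in 𝓝 0, deriv φ x = D x := by
      filter_upwards [Filter.EventuallyEq.deriv hφμ, hμ.eventually_analyticAt] with x h1 h2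
      rw [h1]
      refine HasDerivAt.deriv
        (((hasDerivAt_id x).mul h2.differentiableAt.hasDerivAt).congr_deriv ?_)
      simp [hD]
    -- Solving `φ' g = φ^r (1 + c₁ φ^(r-1))` for `g`, with `r = 2 + k`, `φ = x μ` and `φ' = D`,
    -- gives `g = x² γ`.
    set γ : ℂ → ℂ := fun x => x ^ k * (μ x ^ (2 + k) * (1 + c₁ * (x * μ x) ^ (k + 1))) / D x
      with hγ
    have hγa : AnalyticAt ℂ γ 0 :=
      ((analyticAt_id.pow k).mul ((hμ.pow (2 + k)).mul (analyticAt_const.add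
        (analyticAt_const.mul ((analyticAt_id.mul hμ).pow (k + 1)))))).div hDa
        (by rwa [hD0])
    have hgγ : ∀ᶠ x in 𝓝 0, g x = x ^ 2 * γ x := by
      filter_upwards [hg, hφμ, hφD, hDa.continuousAt.eventually_ne (by rwa [hD0])]
        with x h1 h2 h3 h4
      rw [N2.EulerNormalForm.coeff, h2, h3, show 2 + k - 1 = k + 1 by omega] at h1
      simp only [hγ]
      field_simp
      rw [mul_comm, h1]
      ring
    obtain ⟨d0, d1, d2, d3⟩ := derivs_of_eq_sq_mul hγa hgγ
    rcases h with h | h | h | ⟨h2, h3⟩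
    · exfalso
      have hne : ∀ᶠ x in 𝓝 (0 : ℂ), 1 + c₁ * (x * μ x) ^ (k + 1) ≠ 0 := by
        have hc : ContinuousAt (fun x => 1 + c₁ * (x * μ x) ^ (k + 1)) 0 := by
          have := hμ.continuousAt
          fun_prop
        exact hc.eventually_ne (by simp)
      have : ∀ᶠ x in 𝓝[≠] (0 : ℂ), False := by
        filter_upwards [h.filter_mono nhdsWithin_le_nhds, hgγ.filter_mono nhdsWithin_le_nhds,
          hne.filter_mono nhdsWithin_le_nhds,
          (hμ.continuousAt.eventually_ne hμne).filter_mono nhdsWithin_le_nhds,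
          (hDa.continuousAt.eventually_ne (by rwa [hD0])).filter_mono nhdsWithin_le_nhds,
          self_mem_nhdsWithin] with x h1 h2 h3 h4 h5 h6
        have h6 : x ≠ 0 := h6
        rw [h1] at h2
        exact mul_ne_zero (pow_ne_zero _ h6) (div_ne_zero (mul_ne_zero (pow_ne_zero _ h6)
          (mul_ne_zero (pow_ne_zero _ h4) h3)) h5) h2.symm
      exact this.exists.choose_spec
    · exact absurd d0 h
    · exact absurd d1 h
    · have hk : k = 0 := by
        by_contra hk
        refine h2 (d2.trans ?_)
        simp [hγ, hk]
      subst hk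
      refine ⟨rfl, ?_⟩
      have hμd := hμ.differentiableAt.hasDerivAt
      have hnum : HasDerivAt (fun x => x ^ 0 * (μ x ^ (2 + 0) * (1 + c₁ * (x * μ x) ^ (0 + 1))))
          (2 * μ 0 * deriv μ 0 + c₁ * μ 0 ^ 3) 0 := by
        have := (hμd.fun_pow 2).fun_mul
          (((((hasDerivAt_id' (0 : ℂ)).fun_mul hμd).const_mul c₁)).const_add 1)
        simp only [pow_zero, one_mul, add_zero, zero_add, pow_one]
        refine this.congr_deriv ?_
        simp; ring
      have hden : HasDerivAt D (2 * deriv μ 0) 0 := by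
        refine (hμd.add ((hasDerivAt_id' (0 : ℂ)).fun_mul
          hμ.deriv.differentiableAt.hasDerivAt)).congr_deriv ?_
        simp; ring
      have hγd := (hnum.fun_div hden (by rwa [hD0])).deriv
      rw [h3] at d3
      have hγ0 : deriv γ 0 = 0 := by simpa using d3.symm
      rw [hγ, hγd, hD0, div_eq_zero_iff] at hγ0
      have := hγ0.resolve_right (pow_ne_zero _ hμne)
      -- In the numerator of `γ'(0)` the two contributions of `μ'(0)` cancel, so `c₁` does not
      -- depend on the coordinate change and must vanish.
      have h4 : c₁ * μ 0 ^ 4 = 0 := by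
        simp at this
        linear_combination this
      exact (mul_eq_zero.1 h4).resolve_right (pow_ne_zero _ hμne)

end

theorem mainTheorem9 (Δ : Set ℂ) (hΔ : IsOpen Δ) (h0 : (0 : ℂ) ∈ Δ)
    (E : (Fin 2 → ℂ) → (Fin 2 → ℂ)) (hE : N2.IsEulerField E) :
    (N2.IsInducedByTE Δ E ↔
      ∃ N : N2.EulerNormalForm, N2.HasNormalForm E N ∧ N.IsListed) ∧
    (∀ N : N2.EulerNormalForm, N2.HasNormalForm E N →
      (N2.IsInducedByTE Δ E ↔ N.IsListed)) := by
  obtain ⟨c, g, hg, hEg⟩ := hE.exists_eq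
  refine ⟨⟨fun h => (h.hasListedJet hΔ h0 hg hEg).exists_normalForm hg hEg, ?_⟩,
    fun N hN => ⟨fun h => (h.hasListedJet hΔ h0 hg hEg).isListed hEg hN, ?_⟩⟩
  · rintro ⟨N, hN, hl⟩
    exact N2.isInducedByTE_of_isListed Δ hEg hN hl
  · exact N2.isInducedByTE_of_isListed Δ hEg hN
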